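/- **Setting.** Let $R$ be a ring with identity and $\mathcal A$ a small preadditive category; for $A\in\mathcal A$ put $R_A=\operatorname{Hom}_{\mathcal A}(A,A)$. Assume given ring morphisms $\delta_A:R\to R_A$ $(A\in\mathcal A)$ such that $\delta_B(r)\circ f=f\circ\delta_A(r)$ for all $f:A\to B$ in $\mathcal A$ and $r\in R$. For an additive functor $X:\mathcal A\to R\text{-Mod}$, the group $X(A)$ is a left $R_A$-module via $f\cdot a=X(f)(a)$. Let $\mathrm{Add}(\mathcal A,R\text{-Mod})$ be the category of additive functors $X:\mathcal A\to R\text{-Mod}$ for which, for every $A$, the $R$-module structure of $X(A)$ is the restriction along $\delta_A$ of this $R_A$-module structure (i.e. $X(\delta_A(r))(a)=ra$), with natural transformations as morphisms. For $M\in R_A\text{-Mod}$ let $$\mathrm q_A(M)=\operatorname{Hom}_{\mathcal A}(A,-)\otimes_{R_A}M,\qquad \mathrm p_A(M)=\operatorname{Hom}_{R_A}(\operatorname{Hom}_{\mathcal A}(-,A),M)$$ in $\mathrm{Add}(\mathcal A,R\text{-Mod})$, where $r\in R$ acts by $r(g\otimes m)=(\delta_B(r)\circ g)\otimes m$ and $(rh)(g)=h(g\circ\delta_B(r))$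 at an object $B$. Let $\mathrm q=\bigoplus_A\mathrm q_A$ and $\mathrm p=\prod_A\mathrm p_A$, as functors $\prod_{A}R_A\text{-Mod}\to\mathrm{Add}(\mathcal A,R\text{-Mod})$. For each $A$ let $\mathcal E_A$ be an exact structure (in the sense of Quillen) on $R_A\text{-Mod}$. Equip $\prod_A R_A\text{-Mod}$ with the product exact structure $\prod_A\mathcal E_A$, and $\mathrm{Add}(\mathcal A,R\text{-Mod})$ with the class $\mathcal E$ of all kernel-cokernel pairs whose evaluation at every $A$ belongs to $\mathcal E_A$. With respect to such a structure, a class $\mathcal S$ of objects has $\mathcal S^\perp=\{Y:\operatorname{Ext}^1(S,Y)=0\ \forall S\in\mathcal S\}$ and ${}^\perp\mathcal S=\{Y:\operatorname{Ext}^1(Y,S)=0\ \forall S\in\mathcal S\}$, where $\operatorname{Ext}^1(C,A)$ is the Yoneda group of equivalence classes of short exact sequences $A\to B\to C$ of the structure; a pair $(\mathcal F,\mathcal G)$ is a cotorsion pair if $\mathcal F^\perp=\mathcal G$ and $\mathcal F={}^\perp\mathcal G$. An object $M$ of $R_A\text{-Mod}$ is $\mathrm q_A$-flat if $\mathrm q_A$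 sends every sequence of $\mathcal E_A$ ending with $M$ to a sequence of $\mathcal E$, and $\mathrm p_A$-coflat if $\mathrm p_A$ sends every sequence of $\mathcal E_A$ starting with $M$ to a sequence of $\mathcal E$. **Proposition.** Let $\mathcal F_A,\mathcal G_A$ be classes of objects of $R_A\text{-Mod}$ $(A\in\mathcal A)$ such that $(\prod_A\mathcal F_A,\prod_A\mathcal G_A)$ is a cotorsion pair in $\prod_A R_A\text{-Mod}$. (i) If for every $A\in\mathcal A$ every object of $\mathcal F_A$ is $\mathrm q_A$-flat, then $$\mathrm q\Big(\prod_A\mathcal F_A\Big)^{\perp}=\{X\in\mathrm{Add}(\mathcal A,R\text{-Mod}) : X(A)\in\mathcal G_A\text{ for every }A\in\mathcal A\}.$$ (ii) If for every $A\in\mathcal A$ every object of $\mathcal G_A$ is $\mathrm p_A$-coflat, then $${}^{\perp}\mathrm p\Big(\prod_A\mathcal G_A\Big)=\{X\in\mathrm{Add}(\mathcal A,R\text{-Mod}) : X(A)\in\mathcal F_A\text{ for every }A\in\mathcal A\}.$$ -/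

import Mathlib

open CategoryTheory CategoryTheory.Limits
open scoped TensorProduct DirectSum

universe u

section ExactStructures

universe v₁ v₂ w₁ w₂ w

/-- Zero morphisms in a product category are formed componentwise. -/
instance piHasZeroMorphisms {I : Type w} (C : I → Type w₁) [∀ i, Category.{v₁} (C i)]
    [∀ i, HasZeroMorphisms (C i)] : HasZeroMorphisms (∀ i, C i) where
  zero X Y := ⟨fun _ => 0⟩
  comp_zero f Z := by funext i; exact comp_zero
  zero_comp X Y Z f := by funext i; exact zero_comp

instance piEvalPreservesZeroMorphisms {I : Type w} (C : I → Type w₁)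
    [∀ i, Category.{v₁} (C i)] [∀ i, HasZeroMorphisms (C i)] (i : I) :
    (Pi.eval C i).PreservesZeroMorphisms where
  map_zero _ _ := rfl

variable {C : Type w₁} [Category.{v₁} C] [HasZeroMorphisms C]
variable {D : Type w₂} [Category.{v₂} D] [HasZeroMorphisms D]

/-- `X₁ ⟶ X₂ ⟶ X₃` is a kernel-cokernel pair: the first map is a kernel of the second one and the
second map is a cokernel of the first one. -/
def IsKernelCokernelPair (S : ShortComplex C) : Prop :=
  Nonempty (IsLimit (KernelFork.ofι S.f S.zero)) ∧
    Nonempty (IsColimit (CokernelCofork.ofπ S.g S.zero))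

/-- Admissible monics of a class of kernel-cokernel pairs. -/
def IsAdmissibleMonic (E : ObjectProperty (ShortComplex C)) {X Y : C} (i : X ⟶ Y) : Prop :=
  ∃ (Z : C) (p : Y ⟶ Z) (h : i ≫ p = 0), E (ShortComplex.mk i p h)

/-- Admissible epics of a class of kernel-cokernel pairs. -/
def IsAdmissibleEpic (E : ObjectProperty (ShortComplex C)) {Y Z : C} (p : Y ⟶ Z) : Prop :=
  ∃ (X : C) (i : X ⟶ Y) (h : i ≫ p = 0), E (ShortComplex.mk i p h)

/-- The class `E` is an exact structure (in the sense of Quillen). -/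
structure IsExactStructure (E : ObjectProperty (ShortComplex C)) : Prop where
  kernelCokernel : ∀ S, E S → IsKernelCokernelPair S
  iso_closed : ∀ S T : ShortComplex C, (S ≅ T) → E S → E T
  id_monic : ∀ X : C, IsAdmissibleMonic E (𝟙 X)
  id_epic : ∀ X : C, IsAdmissibleEpic E (𝟙 X)
  comp_monic : ∀ {X Y Z : C} (i : X ⟶ Y) (j : Y ⟶ Z),
    IsAdmissibleMonic E i → IsAdmissibleMonic E j → IsAdmissibleMonic E (i ≫ j)
  comp_epic : ∀ {X Y Z : C} (p : X ⟶ Y) (q : Y ⟶ Z),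
    IsAdmissibleEpic E p → IsAdmissibleEpic E q → IsAdmissibleEpic E (p ≫ q)
  pushout : ∀ {X Y X' : C} (i : X ⟶ Y) (f : X ⟶ X'), IsAdmissibleMonic E i →
    ∃ (Y' : C) (f' : Y ⟶ Y') (i' : X' ⟶ Y'), IsPushout i f f' i' ∧ IsAdmissibleMonic E i'
  pullback : ∀ {Y Z Z' : C} (p : Y ⟶ Z) (f : Z' ⟶ Z), IsAdmissibleEpic E p →
    ∃ (Y' : C) (f' : Y' ⟶ Y) (p' : Y' ⟶ Z'), IsPullback f' p' p f ∧ IsAdmissibleEpic E p'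

/-- A short exact sequence `A ⟶ mid ⟶ X` in `E`, with fixed ends. -/
structure Extension (E : ObjectProperty (ShortComplex C)) (X A : C) where
  mid : C
  i : A ⟶ mid
  p : mid ⟶ X
  zero : i ≫ p = 0
  mem : E (ShortComplex.mk i p zero)

/-- Two short exact sequences with the same ends are equivalent if there is an isomorphism of the
middle objects compatible with the identities of the ends. -/
instance extensionSetoid (E : ObjectProperty (ShortComplex C)) (X A : C) :
    Setoid (Extension E X A) where
  r S T := ∃ e : S.mid ≅ T.mid, S.i ≫ e.hom = T.i ∧ e.hom ≫ T.p = S.p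
  iseqv :=
    { refl := fun S => ⟨Iso.refl _, by simp, by simp⟩
      symm := by
        rintro S T ⟨e, h₁, h₂⟩
        exact ⟨e.symm, by simp [← h₁], by simp [← h₂]⟩
      trans := by
        rintro S T U ⟨e, h₁, h₂⟩ ⟨e', h₁', h₂'⟩
        exact ⟨e ≪≫ e', by simp [← h₁', ← h₁], by simp [← h₂, ← h₂']⟩ }

/-- The Yoneda extensions `Ext¹_E(X, A)`, as a set: equivalence classes of short exact sequences
`A ⟶ B ⟶ X` in `E`. -/
def YonedaExtOne (E : ObjectProperty (ShortComplex C)) (X A : C) :=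
  Quotient (extensionSetoid E X A)

/-- `Ext¹_E(X, A) = 0`. A group is zero if and only if it has at most one element. -/
def ExtOneVanishes (E : ObjectProperty (ShortComplex C)) (X A : C) : Prop :=
  Subsingleton (YonedaExtOne E X A)

/-- The class `S^⊥`. -/
def rightPerp (E : ObjectProperty (ShortComplex C)) (S : ObjectProperty C) : ObjectProperty C :=
  fun A => ∀ X, S X → ExtOneVanishes E X A

/-- The class `^⊥S`. -/
def leftPerp (E : ObjectProperty (ShortComplex C)) (S : ObjectProperty C) : ObjectProperty C :=
  fun A => ∀ X, S X → ExtOneVanishes E A X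

structure IsCotorsionPair (E : ObjectProperty (ShortComplex C)) (F G : ObjectProperty C) :
    Prop where
  rightPerp_eq : rightPerp E F = G
  leftPerp_eq : F = leftPerp E G

/-- `X` is `q`-flat: every short exact sequence ending with `X` remains exact under `q`. -/
def IsFlatObject (E : ObjectProperty (ShortComplex C)) (E' : ObjectProperty (ShortComplex D))
    (q : C ⥤ D) [q.PreservesZeroMorphisms] (X : C) : Prop :=
  ∀ ⦃A B : C⦄ (i : A ⟶ B) (p : B ⟶ X) (h : i ≫ p = 0),
    E (ShortComplex.mk i p h) → E' ((ShortComplex.mk i p h).map q)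

/-- `X` is `t`-coflat: every short exact sequence starting with `X` remains exact under `t`. -/
def IsCoflatObject (E : ObjectProperty (ShortComplex C)) (E' : ObjectProperty (ShortComplex D))
    (t : C ⥤ D) [t.PreservesZeroMorphisms] (X : C) : Prop :=
  ∀ ⦃A B : C⦄ (i : X ⟶ A) (p : A ⟶ B) (h : i ≫ p = 0),
    E (ShortComplex.mk i p h) → E' ((ShortComplex.mk i p h).map t)

/-- The product class `∏ Fᵢ` of objects of `∏ Cᵢ`. -/
def productClass {I : Type w} {C : I → Type w₁} [∀ i, Category.{v₁} (C i)]
    (F : ∀ i, ObjectProperty (C i)) : ObjectProperty (∀ i, C i) :=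
  fun X => ∀ i, F i (X i)

/-- The product exact structure `∏ Eᵢ` on `∏ Cᵢ`. -/
def productExactStructure {I : Type w} {C : I → Type w₁} [∀ i, Category.{v₁} (C i)]
    [∀ i, HasZeroMorphisms (C i)] (E : ∀ i, ObjectProperty (ShortComplex (C i))) :
    ObjectProperty (ShortComplex (∀ i, C i)) :=
  fun S => ∀ i, E i (S.map (Pi.eval C i))

end ExactStructures

/-- Ring morphisms `δ_A : R → End A` such that `δ_B(r) ∘ f = f ∘ δ_A(r)` for all `f : A ⟶ B`. -/
structure RingActionOn (R : Type u) [Ring R] (𝒜 : Type u) [SmallCategory 𝒜] [Preadditive 𝒜] where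
  δ : ∀ A : 𝒜, R →+* End A
  comm : ∀ {A B : 𝒜} (f : A ⟶ B) (r : R), f ≫ δ B r = δ A r ≫ f

section FunctorCategory

variable {R : Type u} [Ring R] {𝒜 : Type u} [SmallCategory 𝒜] [Preadditive 𝒜]

/-- Additive functors `X : 𝒜 ⥤ R-Mod` for which the `R`-module structure of `X(A)` is the
restriction along `δ_A` of its `End A`-module structure. -/
def isAddFunctor (d : RingActionOn R 𝒜) : ObjectProperty (𝒜 ⥤ ModuleCat.{u} R) :=
  fun X => X.Additive ∧
    ∀ (A : 𝒜) (r : R) (x : X.obj A), (X.map (d.δ A r : A ⟶ A)).hom x = r • x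

/-- The category `Add(𝒜, R-Mod)`. -/
abbrev AddFunctor (d : RingActionOn R 𝒜) := (isAddFunctor d).FullSubcategory

namespace AddFunctor

variable {d : RingActionOn R 𝒜}

/-- The abelian group underlying `X(A)`. -/
def Value (X : AddFunctor d) (A : 𝒜) : Type u := X.obj.obj A

instance (X : AddFunctor d) (A : 𝒜) : AddCommGroup (X.Value A) :=
  inferInstanceAs (AddCommGroup (X.obj.obj A))

/-- The left `End A`-module structure of `X(A)`: `f • a = X(f)(a)`. -/
instance (X : AddFunctor d) (A : 𝒜) : Module (End A) (X.Value A) where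
  smul f a := (X.obj.map (f : A ⟶ A)).hom a
  one_smul a := by
    change (X.obj.map (𝟙 A)).hom a = a
    rw [X.obj.map_id]
    rfl
  mul_smul f g a := by
    change (X.obj.map ((g : A ⟶ A) ≫ (f : A ⟶ A))).hom a
      = (X.obj.map (f : A ⟶ A)).hom ((X.obj.map (g : A ⟶ A)).hom a)
    rw [X.obj.map_comp]
    rfl
  smul_zero f := map_zero (X.obj.map (f : A ⟶ A)).hom
  smul_add f a b := map_add (X.obj.map (f : A ⟶ A)).hom a b
  add_smul f g a := by
    have := X.property.1
    change (X.obj.map ((f : A ⟶ A) + (g : A ⟶ A))).hom a = _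
    rw [Functor.map_add]
    rfl
  zero_smul a := by
    have := X.property.1
    change (X.obj.map (0 : A ⟶ A)).hom a = 0
    rw [Functor.map_zero]
    rfl

/-- The evaluation functor `ev_A : Add(𝒜, R-Mod) ⥤ R_A-Mod`, with `R_A = End A`. -/
def ev (d : RingActionOn R 𝒜) (A : 𝒜) : AddFunctor d ⥤ ModuleCat.{u} (End A) where
  obj X := ModuleCat.of (End A) (X.Value A)
  map {X Y} α := ModuleCat.ofHom (X := X.Value A) (Y := Y.Value A)
    { toFun := fun a => (α.hom.app A).hom a
      map_add' := fun a b => map_add (α.hom.app A).hom a b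
      map_smul' := fun f a => by
        have h := congrArg (fun φ => φ.hom a) (α.hom.naturality (f : A ⟶ A))
        exact h }
  map_id X := rfl
  map_comp α β := rfl

instance (A : 𝒜) : (ev d A).PreservesZeroMorphisms where
  map_zero _ _ := rfl

/-- The class of short exact sequences of `Add(𝒜, R-Mod)` (kernel-cokernel pairs) which belong to
`E_A` after evaluation at each `A`. -/
def pointwiseExactStructure (d : RingActionOn R 𝒜)
    (E : ∀ A : 𝒜, ObjectProperty (ShortComplex (ModuleCat.{u} (End A)))) :
    ObjectProperty (ShortComplex (AddFunctor d)) :=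
  fun S => IsKernelCokernelPair S ∧ ∀ A, E A (S.map (ev d A))

/-- The subgroup of `Hom(A,B) ⊗_ℤ M` generated by the `(g ∘ f) ⊗ m - g ⊗ (f • m)`. -/
def balancedRelations (A B : 𝒜) (M : Type u) [AddCommGroup M] [Module (End A) M] :
    Submodule ℤ ((A ⟶ B) ⊗[ℤ] M) :=
  Submodule.span ℤ {x | ∃ (g : A ⟶ B) (f : End A) (m : M),
    x = ((f : A ⟶ A) ≫ g) ⊗ₜ[ℤ] m - g ⊗ₜ[ℤ] (f • m)}

/-- `Hom(A,B) ⊗_{R_A} M`, with `R_A = End A` (not necessarily commutative). -/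
@[nolint unusedArguments]
def HomTensor (_d : RingActionOn R 𝒜) (A B : 𝒜) (M : Type u) [AddCommGroup M]
    [Module (End A) M] : Type u :=
  ((A ⟶ B) ⊗[ℤ] M) ⧸ balancedRelations A B M

namespace HomTensor

variable {A B B' B'' : 𝒜} {M M' M'' : Type u} [AddCommGroup M] [Module (End A) M]
  [AddCommGroup M'] [Module (End A) M'] [AddCommGroup M''] [Module (End A) M'']

instance : AddCommGroup (HomTensor d A B M) :=
  inferInstanceAs (AddCommGroup (((A ⟶ B) ⊗[ℤ] M) ⧸ balancedRelations A B M))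

/-- The class of `g ⊗ m`. -/
def tmul (d : RingActionOn R 𝒜) (g : A ⟶ B) (m : M) : HomTensor d A B M :=
  Submodule.Quotient.mk (p := balancedRelations A B M) (g ⊗ₜ[ℤ] m)

/-- Additive maps out of `Hom(A,B) ⊗_{R_A} M` are determined by their values on the `g ⊗ m`. -/
theorem hom_ext {N : Type u} [AddCommGroup N] {φ ψ : HomTensor d A B M →+ N}
    (h : ∀ (g : A ⟶ B) (m : M), φ (tmul d g m) = ψ (tmul d g m)) : φ = ψ := by
  ext x
  obtain ⟨y, rfl⟩ := Submodule.Quotient.mk_surjective _ x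
  induction y using TensorProduct.induction_on with
  | zero => exact (map_zero φ).trans (map_zero ψ).symm
  | tmul g m => exact h g m
  | add a b ha hb =>
    exact (map_add φ (Submodule.Quotient.mk a) (Submodule.Quotient.mk b)).trans
      ((congrArg₂ (· + ·) ha hb).trans (map_add ψ _ _).symm)

/-- The map `Hom(A,f) ⊗ φ : g ⊗ m ↦ (f ∘ g) ⊗ φ(m)`. -/
def map (d : RingActionOn R 𝒜) (f : B ⟶ B') (φ : M →ₗ[End A] M') :
    HomTensor d A B M →+ HomTensor d A B' M' :=
  (Submodule.mapQ (balancedRelations A B M) (balancedRelations A B' M')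
    (TensorProduct.map (Preadditive.rightComp A f).toIntLinearMap
      φ.toAddMonoidHom.toIntLinearMap)
    (by
      refine Submodule.span_le.2 ?_
      rintro _ ⟨g, e, m, rfl⟩
      refine Submodule.subset_span ⟨g ≫ f, e, φ m, ?_⟩
      refine (map_sub _ _ _).trans (congrArg₂ (· - ·) ?_ ?_)
      · refine (TensorProduct.map_tmul _ _ _ _).trans ?_
        change (((e : A ⟶ A) ≫ g) ≫ f) ⊗ₜ[ℤ] φ m = _
        rw [Category.assoc]
      · refine (TensorProduct.map_tmul _ _ _ _).trans ?_
        change (g ≫ f) ⊗ₜ[ℤ] φ (e • m) = _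
        rw [map_smul])).toAddMonoidHom

@[simp]
theorem map_tmul (f : B ⟶ B') (φ : M →ₗ[End A] M') (g : A ⟶ B) (m : M) :
    map d f φ (tmul d g m) = tmul d (g ≫ f) (φ m) := rfl

theorem tmul_add_left (g g' : A ⟶ B) (m : M) :
    tmul d (g + g') m = tmul d g m + tmul d g' m :=
  congrArg (Submodule.Quotient.mk (p := balancedRelations A B M)) (TensorProduct.add_tmul g g' m)

theorem tmul_add_right (g : A ⟶ B) (m m' : M) :
    tmul d g (m + m') = tmul d g m + tmul d g m' :=
  congrArg (Submodule.Quotient.mk (p := balancedRelations A B M)) (TensorProduct.tmul_add g m m')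

theorem map_id_id : map d (𝟙 B) (LinearMap.id : M →ₗ[End A] M) = AddMonoidHom.id _ :=
  hom_ext (by simp)

theorem map_map (f : B ⟶ B') (f' : B' ⟶ B'') (φ : M →ₗ[End A] M') (φ' : M' →ₗ[End A] M'') :
    (map d f' φ').comp (map d f φ) = map d (f ≫ f') (φ'.comp φ) :=
  hom_ext (by simp)

theorem map_add_left (f f' : B ⟶ B') (φ : M →ₗ[End A] M') :
    map d (f + f') φ = map d f φ + map d f' φ :=
  hom_ext (by simp [tmul_add_left])

theorem map_zero_right (f : B ⟶ B') : map d f (0 : M →ₗ[End A] M') = 0 :=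
  hom_ext (fun g m => by
    have h : tmul d (g ≫ f) (0 : M') = 0 := by
      have := tmul_add_right (d := d) (g ≫ f) (0 : M') 0
      simpa using this
    simpa using h)

theorem map_zero_left (φ : M →ₗ[End A] M') : map d (0 : B ⟶ B') φ = 0 := by
  have h := map_add_left (d := d) (0 : B ⟶ B') 0 φ
  rw [add_zero] at h
  exact left_eq_add.1 h

/-- The action of `R` on `Hom(A,B) ⊗_{R_A} M`: `r` sends `g ⊗ m` to `(δ_B(r) ∘ g) ⊗ m`. -/
def action (d : RingActionOn R 𝒜) (A B : 𝒜) (M : Type u) [AddCommGroup M]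
    [Module (End A) M] : R →+* AddMonoid.End (HomTensor d A B M) where
  toFun r := map d (d.δ B r : B ⟶ B) LinearMap.id
  map_one' := by
    rw [map_one]
    exact map_id_id
  map_mul' r s := by
    rw [map_mul]
    exact (map_map (d.δ B s : B ⟶ B) (d.δ B r : B ⟶ B) LinearMap.id LinearMap.id).symm
  map_zero' := by
    rw [map_zero]
    exact map_zero_left LinearMap.id
  map_add' r s := by
    rw [map_add]
    exact map_add_left (d.δ B r : B ⟶ B) (d.δ B s : B ⟶ B) LinearMap.id

instance : Module R (HomTensor d A B M) :=
  Module.compHom (HomTensor d A B M) (action d A B M)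

theorem smul_def (r : R) (x : HomTensor d A B M) :
    r • x = map d (d.δ B r : B ⟶ B) LinearMap.id x := rfl

/-- `HomTensor.map` as an `R`-linear map. -/
def lmap (d : RingActionOn R 𝒜) (f : B ⟶ B') (φ : M →ₗ[End A] M') :
    HomTensor d A B M →ₗ[R] HomTensor d A B' M' where
  toFun := map d f φ
  map_add' := map_add _
  map_smul' r x := by
    have h₁ := DFunLike.congr_fun
      (map_map (d := d) (d.δ B r : B ⟶ B) f (LinearMap.id : M →ₗ[End A] M) φ) x
    have h₂ := DFunLike.congr_fun
      (map_map (d := d) f (d.δ B' r : B' ⟶ B') φ (LinearMap.id : M' →ₗ[End A] M')) x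
    have h₃ : f ≫ (d.δ B' r : B' ⟶ B') = (d.δ B r : B ⟶ B) ≫ f := d.comm f r
    rw [h₃] at h₂
    exact h₁.trans h₂.symm

end HomTensor

/-- `q_A(M) = Hom(A,-) ⊗_{R_A} M`. -/
def qAtObj (d : RingActionOn R 𝒜) (A : 𝒜) (M : ModuleCat.{u} (End A)) : AddFunctor d where
  obj :=
    { obj := fun B => ModuleCat.of R (HomTensor d A B M)
      map := fun f => ModuleCat.ofHom (HomTensor.lmap d f LinearMap.id)
      map_id := fun B => by
        ext x
        exact DFunLike.congr_fun (HomTensor.map_id_id (d := d) (M := M)) x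
      map_comp := fun f g => by
        ext x
        exact (DFunLike.congr_fun (HomTensor.map_map (d := d) f g LinearMap.id LinearMap.id) x).symm }
  property :=
    ⟨⟨by
      intro B B' f g
      ext x
      exact DFunLike.congr_fun (HomTensor.map_add_left f g LinearMap.id) x⟩, fun _ _ _ => rfl⟩

/-- The functor `q_A : R_A-Mod ⥤ Add(𝒜, R-Mod)`. -/
def qAt (d : RingActionOn R 𝒜) (A : 𝒜) : ModuleCat.{u} (End A) ⥤ AddFunctor d where
  obj M := qAtObj d A M
  map {M M'} φ := ObjectProperty.homMk
    { app := fun B => ModuleCat.ofHom (HomTensor.lmap d (𝟙 B) φ.hom)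
      naturality := fun B B' f => by
        ext x
        have h₁ := DFunLike.congr_fun
          (HomTensor.map_map (d := d) f (𝟙 B') (LinearMap.id : M →ₗ[End A] M) φ.hom) x
        have h₂ := DFunLike.congr_fun
          (HomTensor.map_map (d := d) (𝟙 B) f φ.hom (LinearMap.id : M' →ₗ[End A] M')) x
        rw [Category.comp_id] at h₁
        rw [Category.id_comp] at h₂
        exact h₁.trans h₂.symm }
  map_id M := by
    ext B x
    exact DFunLike.congr_fun (HomTensor.map_id_id (d := d) (M := M)) x
  map_comp {M M' M''} φ ψ := by
    ext B x
    have h := DFunLike.congr_fun (HomTensor.map_map (d := d) (𝟙 B) (𝟙 B) φ.hom ψ.hom) x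
    rw [Category.comp_id] at h
    exact h.symm

instance (A : 𝒜) : (qAt d A).PreservesZeroMorphisms where
  map_zero M M' := by
    ext B x
    exact DFunLike.congr_fun (HomTensor.map_zero_right (d := d) (𝟙 B)) x

/-- `Hom_{R_A}(Hom(B,A), M)`, where `Hom(B,A)` is a left module over `R_A = End A` by
composition. -/
@[nolint unusedArguments]
def HomHom (_d : RingActionOn R 𝒜) (A B : 𝒜) (M : Type u) [AddCommGroup M]
    [Module (End A) M] : Type u :=
  (B ⟶ A) →ₗ[End A] M

namespace HomHom

variable {A B B' B'' : 𝒜} {M M' M'' : Type u} [AddCommGroup M] [Module (End A) M]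
  [AddCommGroup M'] [Module (End A) M'] [AddCommGroup M''] [Module (End A) M'']

instance : AddCommGroup (HomHom d A B M) :=
  inferInstanceAs (AddCommGroup ((B ⟶ A) →ₗ[End A] M))

/-- The `R_A`-linear map `Hom(f,A) : Hom(B',A) ⟶ Hom(B,A)`, `g ↦ g ∘ f`. -/
def precomp (A : 𝒜) (f : B ⟶ B') : (B' ⟶ A) →ₗ[End A] (B ⟶ A) where
  toFun g := f ≫ g
  map_add' g g' := Preadditive.comp_add _ _ _ f g g'
  map_smul' e g := (Category.assoc f g (e : A ⟶ A)).symm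

/-- An element of `Hom_{R_A}(Hom(B,A), M)` as a linear map. -/
def toLin (h : HomHom d A B M) : (B ⟶ A) →ₗ[End A] M := h

/-- The value of `h` at `g`. -/
def eval (h : HomHom d A B M) (g : B ⟶ A) : M := h.toLin g

theorem ext {h h' : HomHom d A B M} (w : ∀ g, eval h g = eval h' g) : h = h' :=
  LinearMap.ext w

/-- The map `Hom(Hom(f,A), φ) : h ↦ (g ↦ φ (h (g ∘ f)))`. -/
def map (d : RingActionOn R 𝒜) (f : B ⟶ B') (φ : M →ₗ[End A] M') :
    HomHom d A B M →+ HomHom d A B' M' where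
  toFun h := φ.comp (h.toLin.comp (precomp A f))
  map_zero' := LinearMap.ext fun _ => map_zero φ
  map_add' _ _ := LinearMap.ext fun _ => map_add φ _ _

@[simp]
theorem eval_map (f : B ⟶ B') (φ : M →ₗ[End A] M') (h : HomHom d A B M) (g : B' ⟶ A) :
    eval (map d f φ h) g = φ (eval h (f ≫ g)) := rfl

theorem map_id_id (h : HomHom d A B M) :
    map d (𝟙 B) (LinearMap.id : M →ₗ[End A] M) h = h :=
  ext (by simp)

theorem map_map (f : B ⟶ B') (f' : B' ⟶ B'') (φ : M →ₗ[End A] M') (φ' : M' →ₗ[End A] M'')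
    (h : HomHom d A B M) :
    map d f' φ' (map d f φ h) = map d (f ≫ f') (φ'.comp φ) h :=
  ext (by simp)

theorem map_add_left (f f' : B ⟶ B') (φ : M →ₗ[End A] M') (h : HomHom d A B M) :
    map d (f + f') φ h = map d f φ h + map d f' φ h :=
  ext fun g => by
    change φ (h.toLin ((f + f') ≫ g)) = φ (h.toLin (f ≫ g)) + φ (h.toLin (f' ≫ g))
    rw [Preadditive.add_comp, map_add, map_add]

theorem map_zero_left (φ : M →ₗ[End A] M') (h : HomHom d A B M) :
    map d (0 : B ⟶ B') φ h = 0 := by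
  have := map_add_left (0 : B ⟶ B') 0 φ h
  simpa using this

/-- The action of `R` on `Hom_{R_A}(Hom(B,A), M)`: `r` sends `h` to `g ↦ h(g ∘ δ_B(r))`. -/
def action (d : RingActionOn R 𝒜) (A B : 𝒜) (M : Type u) [AddCommGroup M]
    [Module (End A) M] : R →+* AddMonoid.End (HomHom d A B M) where
  toFun r := map d (d.δ B r : B ⟶ B) LinearMap.id
  map_one' := by
    rw [map_one]
    exact AddMonoidHom.ext map_id_id
  map_mul' r s := by
    rw [map_mul]
    exact AddMonoidHom.ext fun h =>
      (map_map (d.δ B s : B ⟶ B) (d.δ B r : B ⟶ B) LinearMap.id LinearMap.id h).symm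
  map_zero' := by
    rw [map_zero]
    exact AddMonoidHom.ext fun h => map_zero_left LinearMap.id h
  map_add' r s := by
    rw [map_add]
    exact AddMonoidHom.ext fun h =>
      map_add_left (d.δ B r : B ⟶ B) (d.δ B s : B ⟶ B) LinearMap.id h

instance : Module R (HomHom d A B M) :=
  Module.compHom (HomHom d A B M) (action d A B M)

theorem smul_def (r : R) (h : HomHom d A B M) :
    r • h = map d (d.δ B r : B ⟶ B) LinearMap.id h := rfl

/-- `HomHom.map` as an `R`-linear map. -/
def lmap (d : RingActionOn R 𝒜) (f : B ⟶ B') (φ : M →ₗ[End A] M') :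
    HomHom d A B M →ₗ[R] HomHom d A B' M' where
  toFun := map d f φ
  map_add' := map_add _
  map_smul' r x := by
    have h₁ := map_map (d := d) (d.δ B r : B ⟶ B) f (LinearMap.id : M →ₗ[End A] M) φ x
    have h₂ := map_map (d := d) f (d.δ B' r : B' ⟶ B') φ (LinearMap.id : M' →ₗ[End A] M') x
    have h₃ : f ≫ (d.δ B' r : B' ⟶ B') = (d.δ B r : B ⟶ B) ≫ f := d.comm f r
    rw [h₃] at h₂
    exact h₁.trans h₂.symm

end HomHom

/-- `p_A(M) = Hom_{R_A}(Hom(-,A), M)`. -/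
def pAtObj (d : RingActionOn R 𝒜) (A : 𝒜) (M : ModuleCat.{u} (End A)) : AddFunctor d where
  obj :=
    { obj := fun B => ModuleCat.of R (HomHom d A B M)
      map := fun f => ModuleCat.ofHom (HomHom.lmap d f LinearMap.id)
      map_id := fun B => by
        ext x
        exact HomHom.map_id_id x
      map_comp := fun f g => by
        ext x
        exact (HomHom.map_map f g LinearMap.id LinearMap.id x).symm }
  property :=
    ⟨⟨by
      intro B B' f g
      ext x
      exact HomHom.map_add_left f g LinearMap.id x⟩, fun _ _ _ => rfl⟩

/-- The functor `p_A : R_A-Mod ⥤ Add(𝒜, R-Mod)`. -/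
def pAt (d : RingActionOn R 𝒜) (A : 𝒜) : ModuleCat.{u} (End A) ⥤ AddFunctor d where
  obj M := pAtObj d A M
  map {M M'} φ := ObjectProperty.homMk
    { app := fun B => ModuleCat.ofHom (HomHom.lmap d (𝟙 B) φ.hom)
      naturality := fun B B' f => by
        ext x
        have h₁ := HomHom.map_map (d := d) f (𝟙 B') (LinearMap.id : M →ₗ[End A] M) φ.hom x
        have h₂ := HomHom.map_map (d := d) (𝟙 B) f φ.hom (LinearMap.id : M' →ₗ[End A] M') x
        rw [Category.comp_id] at h₁
        rw [Category.id_comp] at h₂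
        exact h₁.trans h₂.symm }
  map_id M := by
    ext B x
    exact HomHom.map_id_id x
  map_comp {M M' M''} φ ψ := by
    ext B x
    have h := HomHom.map_map (d := d) (𝟙 B) (𝟙 B) φ.hom ψ.hom x
    rw [Category.comp_id] at h
    exact h.symm

instance (A : 𝒜) : (pAt d A).PreservesZeroMorphisms where
  map_zero M M' := by
    ext B x
    exact HomHom.ext (d := d) fun g => rfl

/-- The direct sum of a family of functors in `Add(𝒜, R-Mod)`, formed pointwise. -/
def directSum {I : Type u} (X : I → AddFunctor d) : AddFunctor d where
  obj :=
    { obj := fun B => ModuleCat.of R (⨁ i, (X i).obj.obj B)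
      map := fun f => ModuleCat.ofHom (DirectSum.lmap fun i => ((X i).obj.map f).hom)
      map_id := fun B => ModuleCat.hom_ext (LinearMap.ext fun (x : ⨁ i, (X i).obj.obj B) =>
        DFinsupp.ext fun i =>
          congrArg (fun φ : (X i).obj.obj B ⟶ (X i).obj.obj B => φ.hom (x i)) ((X i).obj.map_id B))
      map_comp := fun {B _ B''} f g => ModuleCat.hom_ext (LinearMap.ext
        fun (x : ⨁ i, (X i).obj.obj B) => DFinsupp.ext fun i =>
        congrArg (fun φ : (X i).obj.obj B ⟶ (X i).obj.obj B'' => φ.hom (x i))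
          ((X i).obj.map_comp f g)) }
  property := by
    refine ⟨⟨?_⟩, ?_⟩
    · intro B B' f g
      refine ModuleCat.hom_ext (LinearMap.ext fun (x : ⨁ i, (X i).obj.obj B) =>
        DFinsupp.ext fun i => ?_)
      have := (X i).property.1
      exact congrArg (fun φ : (X i).obj.obj B ⟶ (X i).obj.obj B' => φ.hom (x i))
        ((X i).obj.map_add (f := f) (g := g))
    · intro A r x
      exact DFinsupp.ext fun i => (X i).property.2 A r (x i)

/-- The direct sum of a family of morphisms. -/
def directSumMap {I : Type u} {X Y : I → AddFunctor d} (α : ∀ i, X i ⟶ Y i) :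
    directSum X ⟶ directSum Y :=
  ObjectProperty.homMk
    { app := fun B => ModuleCat.ofHom (DirectSum.lmap fun i => ((α i).hom.app B).hom)
      naturality := fun B _ f => ModuleCat.hom_ext (LinearMap.ext
        fun (x : ⨁ i, (X i).obj.obj B) => DFinsupp.ext fun i =>
          congrArg (fun φ => φ.hom (x i)) ((α i).hom.naturality f)) }

/-- The product of a family of functors in `Add(𝒜, R-Mod)`, formed pointwise. -/
def product {I : Type u} (X : I → AddFunctor d) : AddFunctor d where
  obj :=
    { obj := fun B => ModuleCat.of R (∀ i, (X i).obj.obj B)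
      map := fun f => ModuleCat.ofHom
        (LinearMap.pi fun i => ((X i).obj.map f).hom.comp (LinearMap.proj i))
      map_id := fun B => by
        ext x : 2
        funext i
        simp
      map_comp := fun f g => by
        ext x : 2
        funext i
        simp }
  property := by
    refine ⟨⟨?_⟩, ?_⟩
    · intro B B' f g
      ext x : 2
      funext i
      have := (X i).property.1
      change ((X i).obj.map (f + g)).hom (x i) = _
      rw [Functor.map_add]
      rfl
    · intro A r x
      funext i
      exact (X i).property.2 A r (x i)

/-- The product of a family of morphisms. -/
def productMap {I : Type u} {X Y : I → AddFunctor d} (α : ∀ i, X i ⟶ Y i) :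
    product X ⟶ product Y :=
  ObjectProperty.homMk
    { app := fun B => ModuleCat.ofHom
        (LinearMap.pi fun i => ((α i).hom.app B).hom.comp (LinearMap.proj i))
      naturality := fun B B' f => by
        ext x : 2
        funext i
        exact congrArg (fun φ => φ.hom (x i)) ((α i).hom.naturality f) }

/-- The functor `q = ⨁_A q_A : ∏_A R_A-Mod ⥤ Add(𝒜, R-Mod)`. -/
def q (d : RingActionOn R 𝒜) : (∀ A : 𝒜, ModuleCat.{u} (End A)) ⥤ AddFunctor d where
  obj M := directSum fun A => (qAt d A).obj (M A)
  map φ := directSumMap fun A => (qAt d A).map (φ A)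
  map_id M := ObjectProperty.hom_ext _ (NatTrans.ext (funext fun B =>
    ModuleCat.hom_ext (LinearMap.ext fun (x : ⨁ A, ((qAt d A).obj (M A)).obj.obj B) =>
      DFinsupp.ext fun A => congrArg (fun α => (α.hom.app B).hom (x A)) ((qAt d A).map_id (M A)))))
  map_comp {M _ _} φ ψ := ObjectProperty.hom_ext _ (NatTrans.ext (funext fun B =>
    ModuleCat.hom_ext (LinearMap.ext fun (x : ⨁ A, ((qAt d A).obj (M A)).obj.obj B) =>
      DFinsupp.ext fun A => congrArg (fun α => (α.hom.app B).hom (x A)) ((qAt d A).map_comp (φ A) (ψ A)))))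

/-- The functor `p = ∏_A p_A : ∏_A R_A-Mod ⥤ Add(𝒜, R-Mod)`. -/
def p (d : RingActionOn R 𝒜) : (∀ A : 𝒜, ModuleCat.{u} (End A)) ⥤ AddFunctor d where
  obj M := product fun A => (pAt d A).obj (M A)
  map φ := productMap fun A => (pAt d A).map (φ A)
  map_id M := by
    ext B x : 5
    funext A
    exact congrArg (fun α => (α.hom.app B).hom (x A)) ((pAt d A).map_id (M A))
  map_comp φ ψ := by
    ext B x : 5
    funext A
    exact congrArg (fun α => (α.hom.app B).hom (x A)) ((pAt d A).map_comp (φ A) (ψ A))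

end AddFunctor

end FunctorCategory

/-! Evaluation `ev d A` has `qAt d A` as left adjoint and `pAt d A` as right adjoint, and it carries
sequences of `pointwiseExactStructure d E` to sequences of `E A`. The theorem holds because such
adjunctions transport the vanishing of Ext¹.

Suppose M is q_A-flat and Ext¹(q_A(M), X) = 0. Apply q_A to an extension of M by X(A). The counit
q_A(X(A)) ⟶ X extends along the image of the monic, and the transpose of this extended map is a
retraction, so the given sequence splits (`extOneVanishes_ev_of_qAt`). Conversely, suppose Ext¹(M_A,
X(A)) = 0 for every A and evaluate an extension of q(M) by X. The canonical maps M_A ⟶ q(M)(A) lift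
to the middle term at A, and the transposes of the lifts assemble to a section (`extOneVanishes_q`).
This direction needs neither flatness nor exactness of direct sums. Part (ii) is dual
(`extOneVanishes_ev_of_pAt`, `extOneVanishes_p`).

Two reductions connect this with the cotorsion pair. Over the product structure, Ext¹ vanishes
exactly when it vanishes in each component (`extOneVanishes_pi_iff`). The zero modules belong to
every F_A and G_A, so a family concentrated at one A is available and isolates q_A or p_A inside q
or p.

Vanishing of Ext¹ is used in the form "all sequences split", and is exploited through pushouts and
pullbacks. For `AddFunctor d` the axioms of an exact structure are not checked in full: pushouts and
pullbacks of sequences are built pointwise, and they lie in the class by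
`IsExactStructure.of_isIso_τ₃` and `IsExactStructure.of_isIso_τ₁` applied at each object. -/

/-! ### Splittings and the vanishing of Ext¹ -/

section SplitExtensions

universe v₁ w₁

variable {C : Type w₁} [Category.{v₁} C] [Preadditive C] {E : ObjectProperty (ShortComplex C)}
  {X A : C}

/-- The short complex underlying an extension. -/
abbrev Extension.toShortComplex (S : Extension E X A) : ShortComplex C :=
  ShortComplex.mk S.i S.p S.zero

theorem IsKernelCokernelPair.splitting_of_retraction {S : ShortComplex C}
    (hS : IsKernelCokernelPair S) (r : S.X₂ ⟶ S.X₁) (hr : S.f ≫ r = 𝟙 _) :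
    Nonempty S.Splitting := by
  obtain ⟨-, ⟨hc⟩⟩ := hS
  obtain ⟨s, hs⟩ := CokernelCofork.IsColimit.desc' hc (𝟙 _ - r ≫ S.f)
    (by simp [reassoc_of% hr])
  have hs : S.g ≫ s = 𝟙 _ - r ≫ S.f := hs
  refine ⟨⟨r, s, hr, ?_, by rw [hs]; abel⟩⟩
  refine Cofork.IsColimit.hom_ext hc ?_
  change S.g ≫ s ≫ S.g = S.g ≫ 𝟙 _
  rw [reassoc_of% hs]
  simp

theorem IsKernelCokernelPair.splitting_of_section {S : ShortComplex C}
    (hS : IsKernelCokernelPair S) (s : S.X₃ ⟶ S.X₂) (hs : s ≫ S.g = 𝟙 _) :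
    Nonempty S.Splitting := by
  obtain ⟨⟨hk⟩, -⟩ := hS
  obtain ⟨r, hr⟩ := KernelFork.IsLimit.lift' hk (𝟙 _ - S.g ≫ s) (by simp [hs])
  have hr : r ≫ S.f = 𝟙 _ - S.g ≫ s := hr
  refine ⟨⟨r, s, ?_, hs, by rw [hr]; abel⟩⟩
  refine Fork.IsLimit.hom_ext hk ?_
  change (S.f ≫ r) ≫ S.f = 𝟙 _ ≫ S.f
  rw [Category.assoc, hr]
  simp

theorem extOneVanishes_of_splitting
    (h : ∀ S : Extension E X A, Nonempty S.toShortComplex.Splitting) : ExtOneVanishes E X A := by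
  refine ⟨fun a b => ?_⟩
  induction a using Quotient.inductionOn with | _ S
  induction b using Quotient.inductionOn with | _ T
  refine Quotient.sound ?_
  obtain ⟨σ⟩ := h S
  obtain ⟨τ⟩ := h T
  have h₁ : S.i ≫ σ.r = 𝟙 _ := σ.f_r
  have h₂ : σ.s ≫ S.p = 𝟙 _ := σ.s_g
  have h₃ : σ.r ≫ S.i + S.p ≫ σ.s = 𝟙 _ := σ.id
  have k₁ : T.i ≫ τ.r = 𝟙 _ := τ.f_r
  have k₂ : τ.s ≫ T.p = 𝟙 _ := τ.s_g
  have k₃ : τ.r ≫ T.i + T.p ≫ τ.s = 𝟙 _ := τ.id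
  have h₄ : σ.s ≫ σ.r = 0 := σ.s_r
  have k₄ : τ.s ≫ τ.r = 0 := τ.s_r
  have hS := S.zero
  have hT := T.zero
  -- Both middle terms are biproducts of the same ends. The isomorphism leaves one through its
  -- retraction and projection and enters the other through its inclusion and section.
  refine ⟨⟨σ.r ≫ T.i + S.p ≫ τ.s, τ.r ≫ S.i + T.p ≫ σ.s, ?_, ?_⟩, ?_, ?_⟩
  · simp [reassoc_of% k₁, reassoc_of% k₂, reassoc_of% k₄, reassoc_of% hT, h₃]
  · simp [reassoc_of% h₁, reassoc_of% h₂, reassoc_of% h₄, reassoc_of% hS, k₃]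
  · simp [reassoc_of% h₁, reassoc_of% hS]
  · simp [hT, k₂]

/-- Vanishing only says that any two extensions are equivalent, so one split extension `T` in the
class must be supplied for comparison. -/
theorem ExtOneVanishes.splitting (h : ExtOneVanishes E X A) (T : Extension E X A)
    (τ : T.toShortComplex.Splitting) (S : Extension E X A) :
    Nonempty S.toShortComplex.Splitting := by
  obtain ⟨e, h₁, h₂⟩ := Quotient.exact (h.elim (Quotient.mk _ T) (Quotient.mk _ S))
  exact ⟨τ.ofIso (ShortComplex.isoMk (Iso.refl _) e (Iso.refl _) (by simp [h₁]) (by simp [h₂]))⟩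

/-- Transport along an isomorphism uses only that the class is closed under isomorphism, so the
lemma applies to `pointwiseExactStructure` as well. -/
theorem ExtOneVanishes.of_iso_left (hE : ∀ S T : ShortComplex C, (S ≅ T) → E S → E T) {X' : C}
    (e : X ≅ X') (h : ExtOneVanishes E X A) : ExtOneVanishes E X' A := by
  refine ⟨fun a b => ?_⟩
  induction a using Quotient.inductionOn with | _ S
  induction b using Quotient.inductionOn with | _ T
  let pull (S : Extension E X' A) : Extension E X A :=
    ⟨S.mid, S.i, S.p ≫ e.inv, by simp [reassoc_of% S.zero],
      hE S.toShortComplex _ (ShortComplex.isoMk (Iso.refl _) (Iso.refl _) e.symm) S.mem⟩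
  obtain ⟨f, h₁, h₂⟩ := Quotient.exact (h.elim (Quotient.mk _ (pull S)) (Quotient.mk _ (pull T)))
  exact Quotient.sound ⟨f, h₁, by simpa [pull] using congrArg (· ≫ e.hom) h₂⟩

theorem ExtOneVanishes.of_iso_right (hE : ∀ S T : ShortComplex C, (S ≅ T) → E S → E T) {A' : C}
    (e : A ≅ A') (h : ExtOneVanishes E X A) : ExtOneVanishes E X A' := by
  refine ⟨fun a b => ?_⟩
  induction a using Quotient.inductionOn with | _ S
  induction b using Quotient.inductionOn with | _ T
  let push (S : Extension E X A') : Extension E X A :=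
    ⟨S.mid, e.hom ≫ S.i, S.p, by simp [S.zero],
      hE S.toShortComplex _ (ShortComplex.isoMk e.symm (Iso.refl _) (Iso.refl _)) S.mem⟩
  obtain ⟨f, h₁, h₂⟩ := Quotient.exact (h.elim (Quotient.mk _ (push S)) (Quotient.mk _ (push T)))
  exact Quotient.sound ⟨f, by simpa [push] using congrArg (e.inv ≫ ·) h₁, h₂⟩

end SplitExtensions

/-! ### Extensions in a product of categories -/

section ProductStructure

universe w v₁ w₁

variable {I : Type w} {C : I → Type w₁} [∀ i, Category.{v₁} (C i)] [∀ i, HasZeroMorphisms (C i)]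
  {E : ∀ i, ObjectProperty (ShortComplex (C i))} {X A : ∀ i, C i}

theorem ExtOneVanishes.pi (h : ∀ i, ExtOneVanishes (E i) (X i) (A i)) :
    ExtOneVanishes (productExactStructure E) X A := by
  refine ⟨fun a b => ?_⟩
  induction a using Quotient.inductionOn with | _ S
  induction b using Quotient.inductionOn with | _ T
  let comp (S : Extension (productExactStructure E) X A) (i : I) : Extension (E i) (X i) (A i) :=
    ⟨S.mid i, S.i i, S.p i, congrFun S.zero i, S.mem i⟩
  have key i := Quotient.exact ((h i).elim (Quotient.mk _ (comp S i)) (Quotient.mk _ (comp T i)))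
  choose e h₁ h₂ using key
  exact Quotient.sound ⟨⟨fun i => (e i).hom, fun i => (e i).inv,
    funext fun i => (e i).hom_inv_id, funext fun i => (e i).inv_hom_id⟩, funext h₁, funext h₂⟩

/-- The extensions `T` fill the components other than `i`. Without them the statement could fail: if
some component had no extension at all, neither would the product, and its Ext¹ would be a
subsingleton vacuously. -/
theorem ExtOneVanishes.component (h : ExtOneVanishes (productExactStructure E) X A)
    (T : ∀ i, Extension (E i) (X i) (A i)) (i : I) : ExtOneVanishes (E i) (X i) (A i) := by
  classical
  refine ⟨fun a b => ?_⟩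
  induction a using Quotient.inductionOn with | _ S
  induction b using Quotient.inductionOn with | _ S'
  let glue (T : ∀ i, Extension (E i) (X i) (A i)) : Extension (productExactStructure E) X A :=
    ⟨fun j => (T j).mid, fun j => (T j).i, fun j => (T j).p, funext fun j => (T j).zero,
      fun j => (T j).mem⟩
  obtain ⟨e, h₁, h₂⟩ := Quotient.exact (h.elim (Quotient.mk _ (glue (Function.update T i S)))
    (Quotient.mk _ (glue (Function.update T i S'))))
  have key : Function.update T i S i ≈ Function.update T i S' i :=
    ⟨(Pi.eval C i).mapIso e, congrFun h₁ i, congrFun h₂ i⟩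
  rw [Function.update_self, Function.update_self] at key
  exact Quotient.sound key

end ProductStructure

/-! ### Exact structures on a module category -/

section ModuleExactStructures

variable {R : Type u} [Ring R] {E : ObjectProperty (ShortComplex (ModuleCat.{u} R))}

theorem IsKernelCokernelPair.shortExact {S : ShortComplex (ModuleCat.{u} R)}
    (hS : IsKernelCokernelPair S) : S.ShortExact := by
  obtain ⟨⟨hk⟩, ⟨hc⟩⟩ := hS
  exact { exact := S.exact_of_f_is_kernel hk
          mono_f := Fork.IsLimit.mono hk
          epi_g := Cofork.IsColimit.epi hc }

theorem IsExactStructure.shortExact (hE : IsExactStructure E) {S : ShortComplex (ModuleCat.{u} R)}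
    (hS : E S) : S.ShortExact :=
  (hE.kernelCokernel S hS).shortExact

/-- The pushout axiom gives an admissible monic with an unspecified cokernel. The point here is that
the cokernel can be taken to be `S.X₃` itself, so that the new sequence has the same right end. -/
theorem IsExactStructure.exists_pushout (hE : IsExactStructure E)
    {S : ShortComplex (ModuleCat.{u} R)} (hS : E S) {X : ModuleCat.{u} R} (f : S.X₁ ⟶ X) :
    ∃ (Y : ModuleCat.{u} R) (g : S.X₂ ⟶ Y) (i : X ⟶ Y) (p : Y ⟶ S.X₃) (h : i ≫ p = 0),
      IsPushout S.f f g i ∧ g ≫ p = S.g ∧ E (ShortComplex.mk i p h) := by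
  obtain ⟨Y, g, i, hpo, Z, p, hip, hmem⟩ := hE.pushout S.f f ⟨S.X₃, S.g, S.zero, hS⟩
  obtain ⟨-, ⟨hc⟩⟩ := hE.kernelCokernel _ hS
  obtain ⟨-, ⟨hc'⟩⟩ := hE.kernelCokernel _ hmem
  let p' : Y ⟶ S.X₃ := hpo.desc S.g 0 (by simp)
  have hp'₁ : g ≫ p' = S.g := hpo.inl_desc _ _ _
  have hp'₂ : i ≫ p' = 0 := hpo.inr_desc _ _ _
  have : Epi S.g := Cofork.IsColimit.epi hc
  have : Epi p := Cofork.IsColimit.epi hc'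
  have : Epi (g ≫ p') := by rwa [hp'₁]
  have : Epi p' := epi_of_epi g p'
  obtain ⟨l, hl⟩ := CokernelCofork.IsColimit.desc' hc (g ≫ p)
    (by rw [reassoc_of% hpo.w, hip, comp_zero])
  have hl : S.g ≫ l = g ≫ p := hl
  have hl' : p' ≫ l = p := by
    refine hpo.hom_ext ?_ ?_
    · rw [reassoc_of% hp'₁, hl]
    · rw [reassoc_of% hp'₂, hip, zero_comp]
  obtain ⟨m, hm⟩ := CokernelCofork.IsColimit.desc' hc' p' hp'₂
  have hm : p ≫ m = p' := hm
  -- The maps `p` and `p'` factor through each other and both are epic, so the two factorizations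
  -- are mutually inverse.
  let eZ : Z ≅ S.X₃ := ⟨m, l, by rw [← cancel_epi p, reassoc_of% hm, hl', Category.comp_id],
    by rw [← cancel_epi p', reassoc_of% hl', hm, Category.comp_id]⟩
  exact ⟨Y, g, i, p', hp'₂, hpo, hp'₁, hE.iso_closed (ShortComplex.mk i p hip) _
    (ShortComplex.isoMk (Iso.refl _) (Iso.refl _) eZ (by simp) (by simpa [eZ] using hm.symm)) hmem⟩

theorem IsExactStructure.exists_pullback (hE : IsExactStructure E)
    {S : ShortComplex (ModuleCat.{u} R)} (hS : E S) {X : ModuleCat.{u} R} (f : X ⟶ S.X₃) :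
    ∃ (Y : ModuleCat.{u} R) (g : Y ⟶ S.X₂) (i : S.X₁ ⟶ Y) (p : Y ⟶ X) (h : i ≫ p = 0),
      IsPullback g p S.g f ∧ i ≫ g = S.f ∧ E (ShortComplex.mk i p h) := by
  obtain ⟨Y, g, p, hpb, Z, i, hip, hmem⟩ := hE.pullback S.g f ⟨S.X₁, S.f, S.zero, hS⟩
  obtain ⟨⟨hk⟩, -⟩ := hE.kernelCokernel _ hS
  obtain ⟨⟨hk'⟩, -⟩ := hE.kernelCokernel _ hmem
  let i' : S.X₁ ⟶ Y := hpb.lift S.f 0 (by simp)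
  have hi'₁ : i' ≫ g = S.f := hpb.lift_fst _ _ _
  have hi'₂ : i' ≫ p = 0 := hpb.lift_snd _ _ _
  have : Mono S.f := Fork.IsLimit.mono hk
  have : Mono i := Fork.IsLimit.mono hk'
  have : Mono (i' ≫ g) := by rwa [hi'₁]
  have : Mono i' := mono_of_mono i' g
  obtain ⟨l, hl⟩ := KernelFork.IsLimit.lift' hk (i ≫ g)
    (by rw [Category.assoc, hpb.w, reassoc_of% hip, zero_comp])
  have hl : l ≫ S.f = i ≫ g := hl
  have hl' : l ≫ i' = i := by
    refine hpb.hom_ext ?_ ?_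
    · rw [Category.assoc, hi'₁, hl]
    · rw [Category.assoc, hi'₂, hip, comp_zero]
  obtain ⟨m, hm⟩ := KernelFork.IsLimit.lift' hk' i' hi'₂
  have hm : m ≫ i = i' := hm
  let eZ : Z ≅ S.X₁ := ⟨l, m, by rw [← cancel_mono i, Category.assoc, hm, hl', Category.id_comp],
    by rw [← cancel_mono i', Category.assoc, hl', hm, Category.id_comp]⟩
  exact ⟨Y, g, i', p, hi'₂, hpb, hi'₁, hE.iso_closed (ShortComplex.mk i p hip) _
    (ShortComplex.isoMk eZ (Iso.refl _) (Iso.refl _) (by simpa [eZ] using hl') (by simp)) hmem⟩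

/-- An exact structure is closed under pushouts of short exact sequences. -/
theorem IsExactStructure.of_isIso_τ₃ (hE : IsExactStructure E)
    {S T : ShortComplex (ModuleCat.{u} R)} (φ : S ⟶ T) [IsIso φ.τ₃] (hS : E S)
    (hT : T.ShortExact) : E T := by
  -- The morphism `φ` factors through the pushout of `S` along `φ.τ₁`. The remaining factor `ψ` is
  -- an isomorphism at both ends, hence in the middle by the five lemma.
  obtain ⟨Y, g, i, p, hip, hpo, hgp, hmem⟩ := hE.exists_pushout hS φ.τ₁
  let ψ : ShortComplex.mk i p hip ⟶ T :=
    { τ₁ := 𝟙 _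
      τ₂ := hpo.desc φ.τ₂ T.f φ.comm₁₂.symm
      τ₃ := φ.τ₃
      comm₁₂ := by simp
      comm₂₃ := by
        refine hpo.hom_ext ?_ ?_
        · simp [φ.comm₂₃, reassoc_of% hgp]
        · simp [reassoc_of% hip] }
  have : IsIso ψ.τ₁ := inferInstanceAs (IsIso (𝟙 _))
  have : IsIso ψ.τ₃ := inferInstanceAs (IsIso φ.τ₃)
  have : IsIso ψ.τ₂ :=
    ShortComplex.isIso₂_of_shortExact_of_isIso₁₃ ψ (hE.shortExact hmem) hT
  have : IsIso ψ := ShortComplex.isIso_of_isIso ψ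
  exact hE.iso_closed _ _ (asIso ψ) hmem

/-- An exact structure is closed under pullbacks of short exact sequences. -/
theorem IsExactStructure.of_isIso_τ₁ (hE : IsExactStructure E)
    {S T : ShortComplex (ModuleCat.{u} R)} (φ : S ⟶ T) [IsIso φ.τ₁] (hS : S.ShortExact)
    (hT : E T) : E S := by
  obtain ⟨Y, g, i, p, hip, hpb, hig, hmem⟩ := hE.exists_pullback hT φ.τ₃
  let ψ : S ⟶ ShortComplex.mk i p hip :=
    { τ₁ := φ.τ₁
      τ₂ := hpb.lift φ.τ₂ S.g φ.comm₂₃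
      τ₃ := 𝟙 _
      comm₁₂ := by
        refine hpb.hom_ext ?_ ?_
        · simp [φ.comm₁₂, hig]
        · simp [hip]
      comm₂₃ := by simp }
  have : IsIso ψ.τ₁ := inferInstanceAs (IsIso φ.τ₁)
  have : IsIso ψ.τ₃ := inferInstanceAs (IsIso (𝟙 _))
  have : IsIso ψ.τ₂ :=
    ShortComplex.isIso₂_of_shortExact_of_isIso₁₃ ψ hS (hE.shortExact hmem)
  have : IsIso ψ := ShortComplex.isIso_of_isIso ψ
  exact hE.iso_closed _ _ (asIso ψ).symm hmem

/-- An exact structure contains all split short exact sequences. -/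
theorem IsExactStructure.of_splitting (hE : IsExactStructure E)
    {S : ShortComplex (ModuleCat.{u} R)} (σ : S.Splitting) : E S := by
  -- A split sequence is a pushout of the trivial sequence ending in the identity of `S.X₃`. The
  -- section `σ.s` provides the map from the trivial sequence to `S`.
  obtain ⟨K, i, hi, hmem⟩ := hE.id_epic S.X₃
  obtain rfl : i = 0 := by simpa using hi
  let φ : ShortComplex.mk (0 : K ⟶ S.X₃) (𝟙 S.X₃) hi ⟶ S :=
    { τ₁ := 0
      τ₂ := σ.s
      τ₃ := 𝟙 _ }
  have : IsIso φ.τ₃ := inferInstanceAs (IsIso (𝟙 _))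
  exact hE.of_isIso_τ₃ φ hmem σ.shortExact

theorem IsExactStructure.exists_split_extension (hE : IsExactStructure E)
    (X A : ModuleCat.{u} R) :
    ∃ T : Extension E X A, Nonempty T.toShortComplex.Splitting := by
  let S : ShortComplex (ModuleCat.{u} R) :=
    ShortComplex.mk (biprod.inl : A ⟶ A ⊞ X) biprod.snd (by simp)
  let σ : S.Splitting :=
    { r := biprod.fst
      s := biprod.inr
      f_r := by simp [S]
      s_g := by simp [S]
      id := by simp [S] }
  exact ⟨⟨A ⊞ X, biprod.inl, biprod.snd, by simp, hE.of_splitting σ⟩, ⟨σ⟩⟩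

theorem IsExactStructure.splitting_of_extOneVanishes (hE : IsExactStructure E)
    {X A : ModuleCat.{u} R} (h : ExtOneVanishes E X A) (S : Extension E X A) :
    Nonempty S.toShortComplex.Splitting := by
  obtain ⟨T, ⟨τ⟩⟩ := hE.exists_split_extension X A
  exact h.splitting T τ S

/-- If `Ext¹(S₃, X) = 0`, then every morphism `S₁ ⟶ X` extends along `S₁ ⟶ S₂`. -/
theorem IsExactStructure.exists_extension (hE : IsExactStructure E)
    {S : ShortComplex (ModuleCat.{u} R)} (hS : E S) {X : ModuleCat.{u} R}
    (h : ExtOneVanishes E S.X₃ X) (f : S.X₁ ⟶ X) : ∃ g : S.X₂ ⟶ X, S.f ≫ g = f := by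
  -- The pushout along `f` is an extension of `S.X₃` by `X`, so it splits, and its retraction
  -- composed with `g` extends `f`.
  obtain ⟨Y, g, i, p, hip, hpo, -, hmem⟩ := hE.exists_pushout hS f
  obtain ⟨σ⟩ := hE.splitting_of_extOneVanishes h ⟨Y, i, p, hip, hmem⟩
  have hσ : i ≫ σ.r = 𝟙 _ := σ.f_r
  exact ⟨g ≫ σ.r, by rw [reassoc_of% hpo.w, hσ, Category.comp_id]⟩

/-- If `Ext¹(X, S₁) = 0`, then every morphism `X ⟶ S₃` lifts along `S₂ ⟶ S₃`. -/
theorem IsExactStructure.exists_lift (hE : IsExactStructure E)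
    {S : ShortComplex (ModuleCat.{u} R)} (hS : E S) {X : ModuleCat.{u} R}
    (h : ExtOneVanishes E X S.X₁) (f : X ⟶ S.X₃) : ∃ g : X ⟶ S.X₂, g ≫ S.g = f := by
  obtain ⟨Y, g, i, p, hip, hpb, -, hmem⟩ := hE.exists_pullback hS f
  obtain ⟨σ⟩ := hE.splitting_of_extOneVanishes h ⟨Y, i, p, hip, hmem⟩
  have hσ : σ.s ≫ p = 𝟙 _ := σ.s_g
  exact ⟨σ.s ≫ g, by rw [Category.assoc, hpb.w, reassoc_of% hσ]⟩

theorem IsExactStructure.extOneVanishes_of_isZero_left (hE : IsExactStructure E)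
    {X : ModuleCat.{u} R} (hX : IsZero X) (A : ModuleCat.{u} R) : ExtOneVanishes E X A :=
  extOneVanishes_of_splitting fun S =>
    (hE.kernelCokernel _ S.mem).splitting_of_section 0 (hX.eq_of_src _ _)

theorem IsExactStructure.extOneVanishes_of_isZero_right (hE : IsExactStructure E)
    (X : ModuleCat.{u} R) {A : ModuleCat.{u} R} (hA : IsZero A) : ExtOneVanishes E X A :=
  extOneVanishes_of_splitting fun S =>
    (hE.kernelCokernel _ S.mem).splitting_of_retraction 0 (hA.eq_of_src _ _)

end ModuleExactStructures

section ProductOfModuleCategories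

variable {I : Type u} {R : I → Type u} [∀ i, Ring (R i)]
  {E : ∀ i, ObjectProperty (ShortComplex (ModuleCat.{u} (R i)))}

theorem extOneVanishes_pi_iff (hE : ∀ i, IsExactStructure (E i)) (X A : ∀ i, ModuleCat.{u} (R i)) :
    ExtOneVanishes (productExactStructure E) X A ↔ ∀ i, ExtOneVanishes (E i) (X i) (A i) :=
  ⟨fun h => h.component fun i => ((hE i).exists_split_extension (X i) (A i)).choose,
    ExtOneVanishes.pi⟩

end ProductOfModuleCategories

/-! ### Additive functors as natural linear data, and pointwise exactness -/

namespace AddFunctor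

variable {R : Type u} [Ring R] {𝒜 : Type u} [SmallCategory 𝒜] [Preadditive 𝒜]
  {d : RingActionOn R 𝒜} {X Y Z : AddFunctor d}

/-- The linear map `X(f)`. -/
def lin (X : AddFunctor d) {B B' : 𝒜} (f : B ⟶ B') : X.obj.obj B →ₗ[R] X.obj.obj B' :=
  (X.obj.map f).hom

theorem lin_id (X : AddFunctor d) (B : 𝒜) (x : X.obj.obj B) : X.lin (𝟙 B) x = x := by
  simp [lin]

theorem lin_comp (X : AddFunctor d) {B B' B'' : 𝒜} (f : B ⟶ B') (g : B' ⟶ B'')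
    (x : X.obj.obj B) : X.lin (f ≫ g) x = X.lin g (X.lin f x) := by
  simp [lin]

theorem lin_add (X : AddFunctor d) {B B' : 𝒜} (f g : B ⟶ B') (x : X.obj.obj B) :
    X.lin (f + g) x = X.lin f x + X.lin g x := by
  have := X.property.1
  simp [lin, Functor.map_add]

theorem lin_δ (X : AddFunctor d) (B : 𝒜) (r : R) (x : X.obj.obj B) :
    X.lin (d.δ B r : B ⟶ B) x = r • x :=
  X.property.2 B r x

/-- An object of `Add(𝒜, R-Mod)` from modules and linear maps. -/
def ofLin (M : 𝒜 → Type u) [∀ B, AddCommGroup (M B)] [∀ B, Module R (M B)]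
    (l : ∀ {B B' : 𝒜}, (B ⟶ B') → (M B →ₗ[R] M B')) (l_id : ∀ B (x : M B), l (𝟙 B) x = x)
    (l_comp : ∀ {B B' B'' : 𝒜} (f : B ⟶ B') (g : B' ⟶ B'') (x : M B), l (f ≫ g) x = l g (l f x))
    (l_add : ∀ {B B' : 𝒜} (f g : B ⟶ B') (x : M B), l (f + g) x = l f x + l g x)
    (l_δ : ∀ B (r : R) (x : M B), l (d.δ B r : B ⟶ B) x = r • x) : AddFunctor d where
  obj :=
    { obj := fun B => ModuleCat.of R (M B)
      map := fun f => ModuleCat.ofHom (l f)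
      map_id := fun B => ModuleCat.hom_ext (LinearMap.ext (l_id B))
      map_comp := fun f g => ModuleCat.hom_ext (LinearMap.ext (l_comp f g)) }
  property := ⟨⟨fun {_ _ f g} => ModuleCat.hom_ext (LinearMap.ext (l_add f g))⟩, l_δ⟩

/-- The components of a morphism, as linear maps. -/
def comp (α : X ⟶ Y) (B : 𝒜) : X.obj.obj B →ₗ[R] Y.obj.obj B := (α.hom.app B).hom

theorem comp_lin (α : X ⟶ Y) {B B' : 𝒜} (f : B ⟶ B') (x : X.obj.obj B) :
    comp α B' (X.lin f x) = Y.lin f (comp α B x) :=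
  congrArg (fun φ => φ.hom x) (α.hom.naturality f)

/-- A morphism from a natural family of linear maps. -/
def homOfLin (l : ∀ B, X.obj.obj B →ₗ[R] Y.obj.obj B)
    (h : ∀ {B B' : 𝒜} (f : B ⟶ B') (x : X.obj.obj B), l B' (X.lin f x) = Y.lin f (l B x)) :
    X ⟶ Y :=
  ObjectProperty.homMk
    { app := fun B => ModuleCat.ofHom (l B)
      naturality := fun _ _ f => ModuleCat.hom_ext (LinearMap.ext (h f)) }

@[simp]
theorem comp_comp (α : X ⟶ Y) (β : Y ⟶ Z) (B : 𝒜) (x : X.obj.obj B) :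
    comp (α ≫ β) B x = comp β B (comp α B x) := rfl

@[simp]
theorem comp_zero' (B : 𝒜) (x : X.obj.obj B) : comp (0 : X ⟶ Y) B x = 0 := rfl

theorem hom_ext {α β : X ⟶ Y} (h : ∀ B x, comp α B x = comp β B x) : α = β :=
  ObjectProperty.hom_ext _ (NatTrans.ext (funext fun B =>
    ModuleCat.hom_ext (LinearMap.ext (h B))))

instance (A : 𝒜) : (ev d A).Additive where
  map_add := rfl

section PointwiseExactness

variable {S : ShortComplex (AddFunctor d)}

theorem shortExact_map_ev_iff (B : 𝒜) : (S.map (ev d B)).ShortExact ↔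
    Function.Injective (comp S.f B) ∧ Function.Surjective (comp S.g B) ∧
      ∀ x, comp S.g B x = 0 → ∃ y, comp S.f B y = x := by
  constructor
  · intro h
    exact ⟨h.moduleCat_injective_f, h.moduleCat_surjective_g,
      (ShortComplex.moduleCat_exact_iff _).1 h.exact⟩
  · rintro ⟨h₁, h₂, h₃⟩
    exact { exact := (ShortComplex.moduleCat_exact_iff _).2 h₃
            mono_f := (ModuleCat.mono_iff_injective _).2 h₁
            epi_g := (ModuleCat.epi_iff_surjective _).2 h₂ }

/-- Exactness depends only on the underlying groups, so it passes from `End B`-modules to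
`R`-modules. The `R`-linear version is needed to construct morphisms of functors. -/
theorem shortExact_evaluation (h : ∀ B, (S.map (ev d B)).ShortExact) (B : 𝒜) :
    (S.map ((isAddFunctor d).ι ⋙ (evaluation _ _).obj B)).ShortExact := by
  obtain ⟨h₁, h₂, h₃⟩ := (shortExact_map_ev_iff B).1 (h B)
  exact { exact := (ShortComplex.moduleCat_exact_iff _).2 h₃
          mono_f := (ModuleCat.mono_iff_injective _).2 h₁
          epi_g := (ModuleCat.epi_iff_surjective _).2 h₂ }

/-- The factorizations are chosen separately at each object. They are automatically natural, because
`S.f` is injective and `S.g` is surjective at every object. -/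
theorem isKernelCokernelPair_of_shortExact_ev (h : ∀ B, (S.map (ev d B)).ShortExact) :
    IsKernelCokernelPair S := by
  have hS := shortExact_evaluation h
  have h₀ B := (shortExact_map_ev_iff B).1 (h B)
  constructor
  · have key (W : AddFunctor d) (k : W ⟶ S.X₂) (hk : k ≫ S.g = 0) : ∃ l : W ⟶ S.X₁, l ≫ S.f = k := by
      have hk' B : k.hom.app B ≫ S.g.hom.app B = 0 :=
        congrArg (fun α : W ⟶ S.X₃ => α.hom.app B) hk
      have hex B : ∃ l : W.obj.obj B →ₗ[R] S.X₁.obj.obj B, ∀ x, comp S.f B (l x) = comp k B x :=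
        let l := KernelFork.IsLimit.lift' (hS B).fIsKernel (k.hom.app B) (hk' B)
        ⟨l.1.hom, fun x => congrArg (fun φ => φ.hom x) l.2⟩
      choose l hl' using hex
      refine ⟨homOfLin l fun {B B'} f x => (h₀ B').1 ?_, hom_ext hl'⟩
      rw [comp_lin, hl', comp_lin]
      exact congrArg _ (hl' B x).symm
    choose l hl using key
    refine ⟨KernelFork.IsLimit.ofι _ _ (l _) (hl _) fun k hk m hm => hom_ext fun B x => (h₀ B).1 ?_⟩
    rw [← comp_comp, ← comp_comp, hm, hl]
  · have key (W : AddFunctor d) (k : S.X₂ ⟶ W) (hk : S.f ≫ k = 0) : ∃ l : S.X₃ ⟶ W, S.g ≫ l = k := by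
      have hk' B : S.f.hom.app B ≫ k.hom.app B = 0 :=
        congrArg (fun α : S.X₁ ⟶ W => α.hom.app B) hk
      have hex B : ∃ l : S.X₃.obj.obj B →ₗ[R] W.obj.obj B, ∀ x, l (comp S.g B x) = comp k B x :=
        let l := CokernelCofork.IsColimit.desc' (hS B).gIsCokernel (k.hom.app B) (hk' B)
        ⟨l.1.hom, fun x => congrArg (fun φ => φ.hom x) l.2⟩
      choose l hl' using hex
      refine ⟨homOfLin l fun {B B'} f y => ?_, hom_ext hl'⟩
      obtain ⟨x, rfl⟩ := (h₀ B).2.1 y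
      rw [← comp_lin, hl', comp_lin]
      exact congrArg _ (hl' B x).symm
    choose l hl using key
    refine ⟨CokernelCofork.IsColimit.ofπ _ _ (l _) (hl _) fun k hk m hm => hom_ext fun B y => ?_⟩
    obtain ⟨x, rfl⟩ := (h₀ B).2.1 y
    rw [← comp_comp, ← comp_comp, hm, hl]

end PointwiseExactness

section PointwiseExactStructure

variable {E : ∀ A : 𝒜, ObjectProperty (ShortComplex (ModuleCat.{u} (End A)))}

theorem shortExact_ev (hE : ∀ A, IsExactStructure (E A)) {S : ShortComplex (AddFunctor d)}
    (hS : pointwiseExactStructure d E S) (B : 𝒜) : (S.map (ev d B)).ShortExact :=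
  (hE B).shortExact (hS.2 B)

/-- This places pushout sequences in the class: pointwise short exactness of `T` suffices,
membership in each `E A` being inherited from `S`. -/
theorem pointwiseExactStructure_of_isIso_τ₃ (hE : ∀ A, IsExactStructure (E A))
    {S T : ShortComplex (AddFunctor d)} (φ : S ⟶ T) [IsIso φ.τ₃]
    (hS : pointwiseExactStructure d E S) (hT : ∀ B, (T.map (ev d B)).ShortExact) :
    pointwiseExactStructure d E T := by
  refine ⟨isKernelCokernelPair_of_shortExact_ev hT, fun B => ?_⟩
  let ψ : S.map (ev d B) ⟶ T.map (ev d B) := (ev d B).mapShortComplex.map φ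
  have : IsIso ψ.τ₃ := inferInstanceAs (IsIso ((ev d B).map φ.τ₃))
  exact (hE B).of_isIso_τ₃ ψ (hS.2 B) (hT B)

theorem pointwiseExactStructure_of_isIso_τ₁ (hE : ∀ A, IsExactStructure (E A))
    {S T : ShortComplex (AddFunctor d)} (φ : S ⟶ T) [IsIso φ.τ₁]
    (hS : ∀ B, (S.map (ev d B)).ShortExact) (hT : pointwiseExactStructure d E T) :
    pointwiseExactStructure d E S := by
  refine ⟨isKernelCokernelPair_of_shortExact_ev hS, fun B => ?_⟩
  let ψ : S.map (ev d B) ⟶ T.map (ev d B) := (ev d B).mapShortComplex.map φ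
  have : IsIso ψ.τ₁ := inferInstanceAs (IsIso ((ev d B).map φ.τ₁))
  exact (hE B).of_isIso_τ₁ ψ (hS B) (hT.2 B)

theorem pointwiseExactStructure_of_splitting (hE : ∀ A, IsExactStructure (E A))
    {S : ShortComplex (AddFunctor d)} (σ : S.Splitting) : pointwiseExactStructure d E S :=
  ⟨isKernelCokernelPair_of_shortExact_ev fun B => (σ.map (ev d B)).shortExact,
    fun B => (hE B).of_splitting (σ.map (ev d B))⟩

theorem pointwiseExactStructure_of_iso (hE : ∀ A, IsExactStructure (E A))
    (S T : ShortComplex (AddFunctor d)) (e : S ≅ T) (hS : pointwiseExactStructure d E S) :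
    pointwiseExactStructure d E T :=
  pointwiseExactStructure_of_isIso_τ₃ hE e.hom hS fun B =>
    ShortComplex.shortExact_of_iso ((ev d B).mapShortComplex.mapIso e) (shortExact_ev hE hS B)

end PointwiseExactStructure

/-! ### Pointwise pushouts and pullbacks of short exact sequences -/

section Constructions

/-- The pointwise product of two functors. -/
def prod (X Y : AddFunctor d) : AddFunctor d :=
  ofLin (fun B => X.obj.obj B × Y.obj.obj B) (fun f => (X.lin f).prodMap (Y.lin f))
    (fun _ _ => Prod.ext (lin_id _ _ _) (lin_id _ _ _))
    (fun _ _ _ => Prod.ext (lin_comp _ _ _ _) (lin_comp _ _ _ _))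
    (fun _ _ _ => Prod.ext (lin_add _ _ _ _) (lin_add _ _ _ _))
    (fun _ _ _ => Prod.ext (lin_δ _ _ _ _) (lin_δ _ _ _ _))

/-- A subfunctor. -/
def sub (X : AddFunctor d) (N : ∀ B, Submodule R (X.obj.obj B))
    (h : ∀ {B B' : 𝒜} (f : B ⟶ B'), N B ≤ (N B').comap (X.lin f)) : AddFunctor d :=
  ofLin (fun B => N B) (fun f => (X.lin f).restrict (h f))
    (fun _ _ => Subtype.ext (lin_id _ _ _)) (fun _ _ _ => Subtype.ext (lin_comp _ _ _ _))
    (fun _ _ _ => Subtype.ext (lin_add _ _ _ _)) (fun _ _ _ => Subtype.ext (lin_δ _ _ _ _))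

/-- A quotient functor. -/
def quot (X : AddFunctor d) (N : ∀ B, Submodule R (X.obj.obj B))
    (h : ∀ {B B' : 𝒜} (f : B ⟶ B'), N B ≤ (N B').comap (X.lin f)) : AddFunctor d :=
  ofLin (fun B => X.obj.obj B ⧸ N B) (fun {B B'} f => (N B).mapQ (N B') (X.lin f) (h f))
    (fun B x => by
      obtain ⟨x, rfl⟩ := Submodule.Quotient.mk_surjective _ x
      exact congrArg Submodule.Quotient.mk (lin_id X B x))
    (fun f g x => by
      obtain ⟨x, rfl⟩ := Submodule.Quotient.mk_surjective _ x
      exact congrArg Submodule.Quotient.mk (lin_comp X f g x))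
    (fun f g x => by
      obtain ⟨x, rfl⟩ := Submodule.Quotient.mk_surjective _ x
      exact congrArg Submodule.Quotient.mk (lin_add X f g x))
    (fun B r x => by
      obtain ⟨x, rfl⟩ := Submodule.Quotient.mk_surjective _ x
      exact congrArg Submodule.Quotient.mk (lin_δ X B r x))

theorem exists_pushout (S : ShortComplex (AddFunctor d)) (hS : ∀ B, (S.map (ev d B)).ShortExact)
    (f : S.X₁ ⟶ X) :
    ∃ (P : AddFunctor d) (i : X ⟶ P) (p : P ⟶ S.X₃) (h : i ≫ p = 0) (j : S.X₂ ⟶ P),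
      f ≫ i = S.f ≫ j ∧ j ≫ p = S.g ∧
        ∀ B, ((ShortComplex.mk i p h).map (ev d B)).ShortExact := by
  have h₀ B := (shortExact_map_ev_iff B).1 (hS B)
  have hfg B x : comp S.g B (comp S.f B x) = 0 := by rw [← comp_comp, S.zero, comp_zero']
  -- The pushout is the quotient of the product by the elements (f(x), -S.f(x)).
  let N (B : 𝒜) : Submodule R ((prod X S.X₂).obj.obj B) :=
    LinearMap.range ((comp f B).prod (-comp S.f B))
  have hN {B B' : 𝒜} (g : B ⟶ B') : N B ≤ (N B').comap ((prod X S.X₂).lin g) := by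
    rintro _ ⟨x, rfl⟩
    exact ⟨S.X₁.lin g x, Prod.ext (comp_lin f g x)
      ((congrArg Neg.neg (comp_lin S.f g x)).trans (map_neg (S.X₂.lin g) _).symm)⟩
  let P := quot (prod X S.X₂) N hN
  let i : X ⟶ P := homOfLin (fun B => (N B).mkQ ∘ₗ LinearMap.inl R _ _) fun {B B'} g x =>
    congrArg (N B').mkQ (Prod.ext rfl (map_zero (S.X₂.lin g)).symm)
  let j : S.X₂ ⟶ P := homOfLin (fun B => (N B).mkQ ∘ₗ LinearMap.inr R _ _) fun {B B'} g x =>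
    congrArg (N B').mkQ (Prod.ext (map_zero (X.lin g)).symm rfl)
  let p : P ⟶ S.X₃ := homOfLin
    (fun B => (N B).liftQ (comp S.g B ∘ₗ LinearMap.snd R _ _) (by
      rintro _ ⟨x, rfl⟩
      exact (map_neg (comp S.g B) _).trans (neg_eq_zero.2 (hfg B x))))
    (fun {B B'} g x => by
      obtain ⟨x, rfl⟩ := Submodule.Quotient.mk_surjective _ x
      exact comp_lin S.g g x.2)
  have hip : i ≫ p = 0 := hom_ext fun B x => map_zero (comp S.g B)
  have hfi : f ≫ i = S.f ≫ j := hom_ext fun B x =>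
    (Submodule.Quotient.eq (N B)).2 ⟨x, Prod.ext (sub_zero _).symm (zero_sub _).symm⟩
  refine ⟨P, i, p, hip, j, hfi, hom_ext fun B x => rfl,
    fun B => (shortExact_map_ev_iff B).2 ⟨?_, ?_, ?_⟩⟩
  · refine (injective_iff_map_eq_zero _).2 fun x hx => ?_
    obtain ⟨y, hy⟩ := (Submodule.Quotient.mk_eq_zero (N B)).1 hx
    have h₁ : comp f B y = x := congrArg Prod.fst hy
    have h₂ : -comp S.f B y = 0 := congrArg Prod.snd hy
    have h₃ : y = 0 := (h₀ B).1 (by rw [neg_eq_zero.1 h₂, map_zero])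
    rw [← h₁, h₃, map_zero]
  · intro z
    obtain ⟨y, rfl⟩ := (h₀ B).2.1 z
    exact ⟨comp j B y, rfl⟩
  · intro w hw
    obtain ⟨⟨x, y⟩, rfl⟩ := Submodule.Quotient.mk_surjective _ w
    obtain ⟨z, rfl⟩ := (h₀ B).2.2 y hw
    refine ⟨x + comp f B z, (Submodule.Quotient.eq (N B)).2 ⟨z, Prod.ext ?_ ?_⟩⟩
    · exact (add_sub_cancel_left x _).symm
    · exact (zero_sub _).symm

theorem exists_pullback (S : ShortComplex (AddFunctor d)) (hS : ∀ B, (S.map (ev d B)).ShortExact)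
    (f : X ⟶ S.X₃) :
    ∃ (P : AddFunctor d) (i : S.X₁ ⟶ P) (p : P ⟶ X) (h : i ≫ p = 0) (j : P ⟶ S.X₂),
      i ≫ j = S.f ∧ j ≫ S.g = p ≫ f ∧
        ∀ B, ((ShortComplex.mk i p h).map (ev d B)).ShortExact := by
  have h₀ B := (shortExact_map_ev_iff B).1 (hS B)
  have hfg B x : comp S.g B (comp S.f B x) = 0 := by rw [← comp_comp, S.zero, comp_zero']
  let N (B : 𝒜) : Submodule R ((prod X S.X₂).obj.obj B) :=
    LinearMap.eqLocus (comp f B ∘ₗ LinearMap.fst R _ _) (comp S.g B ∘ₗ LinearMap.snd R _ _)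
  have hN {B B' : 𝒜} (g : B ⟶ B') : N B ≤ (N B').comap ((prod X S.X₂).lin g) := by
    rintro ⟨x, y⟩ (hxy : comp f B x = comp S.g B y)
    change comp f B' (X.lin g x) = comp S.g B' (S.X₂.lin g y)
    rw [comp_lin, comp_lin, hxy]
  let P := sub (prod X S.X₂) N hN
  let p : P ⟶ X := homOfLin (fun B => LinearMap.fst R _ _ ∘ₗ (N B).subtype) fun _ _ => rfl
  let j : P ⟶ S.X₂ := homOfLin (fun B => LinearMap.snd R _ _ ∘ₗ (N B).subtype) fun _ _ => rfl
  let i : S.X₁ ⟶ P := homOfLin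
    (fun B => LinearMap.codRestrict (N B) (LinearMap.inr R _ _ ∘ₗ comp S.f B) fun x =>
      (map_zero (comp f B)).trans (hfg B x).symm)
    (fun {B B'} g x => Subtype.ext (Prod.ext (map_zero (X.lin g)).symm (comp_lin S.f g x)))
  have hip : i ≫ p = 0 := hom_ext fun B x => rfl
  have hpf : j ≫ S.g = p ≫ f := hom_ext fun B x => x.2.symm
  refine ⟨P, i, p, hip, j, hom_ext fun B x => rfl, hpf,
    fun B => (shortExact_map_ev_iff B).2 ⟨?_, ?_, ?_⟩⟩
  · exact fun x y hxy => (h₀ B).1 (congrArg (fun z => z.1.2) hxy)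
  · intro x
    obtain ⟨y, hy⟩ := (h₀ B).2.1 (comp f B x)
    exact ⟨⟨(x, y), hy.symm⟩, rfl⟩
  · rintro ⟨⟨x, y⟩, hxy : comp f B x = comp S.g B y⟩ (hx : x = 0)
    subst hx
    obtain ⟨z, rfl⟩ := (h₀ B).2.2 y (by rw [← hxy, map_zero])
    exact ⟨z, rfl⟩

end Constructions

/-! ### Extending and lifting morphisms of functors when Ext¹ vanishes -/

section Extensions

variable {E : ∀ A : 𝒜, ObjectProperty (ShortComplex (ModuleCat.{u} (End A)))}

theorem exists_split_extension (hE : ∀ A, IsExactStructure (E A)) (X Y : AddFunctor d) :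
    ∃ T : Extension (pointwiseExactStructure d E) X Y, Nonempty T.toShortComplex.Splitting := by
  let i : Y ⟶ prod Y X := homOfLin (fun B => LinearMap.inl R _ _)
    fun f _ => Prod.ext rfl (map_zero (X.lin f)).symm
  let p : prod Y X ⟶ X := homOfLin (fun B => LinearMap.snd R _ _) fun _ _ => rfl
  let r : prod Y X ⟶ Y := homOfLin (fun B => LinearMap.fst R _ _) fun _ _ => rfl
  let s : X ⟶ prod Y X := homOfLin (fun B => LinearMap.inr R _ _)
    fun f _ => Prod.ext (map_zero (Y.lin f)).symm rfl
  have hip : i ≫ p = 0 := hom_ext fun B x => rfl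
  let σ : (ShortComplex.mk i p hip).Splitting :=
    { r := r
      s := s
      f_r := hom_ext fun B x => rfl
      s_g := hom_ext fun B x => rfl
      id := hom_ext fun B x => Prod.ext (add_zero _) (zero_add _) }
  exact ⟨⟨_, i, p, hip, pointwiseExactStructure_of_splitting hE σ⟩, ⟨σ⟩⟩

/-- If `Ext¹(S₃, X) = 0`, then every morphism `S₁ ⟶ X` extends along `S₁ ⟶ S₂`. -/
theorem exists_extension_of_extOneVanishes (hE : ∀ A, IsExactStructure (E A))
    {S : ShortComplex (AddFunctor d)} (hS : pointwiseExactStructure d E S)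
    (h : ExtOneVanishes (pointwiseExactStructure d E) S.X₃ X) (f : S.X₁ ⟶ X) :
    ∃ g : S.X₂ ⟶ X, S.f ≫ g = f := by
  obtain ⟨P, i, p, hip, j, h₁₂, h₂₃, hT⟩ := exists_pushout S (shortExact_ev hE hS) f
  let φ : S ⟶ ShortComplex.mk i p hip :=
    { τ₁ := f
      τ₂ := j
      τ₃ := 𝟙 _
      comm₁₂ := h₁₂
      comm₂₃ := by simp [h₂₃] }
  have : IsIso φ.τ₃ := inferInstanceAs (IsIso (𝟙 _))
  obtain ⟨T, ⟨τ⟩⟩ := exists_split_extension hE S.X₃ X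
  obtain ⟨σ⟩ := h.splitting T τ
    ⟨P, i, p, hip, pointwiseExactStructure_of_isIso_τ₃ hE φ hS hT⟩
  have hσ : i ≫ σ.r = 𝟙 _ := σ.f_r
  exact ⟨j ≫ σ.r, by rw [← Category.assoc, ← h₁₂, Category.assoc, hσ, Category.comp_id]⟩

/-- If `Ext¹(X, S₁) = 0`, then every morphism `X ⟶ S₃` lifts along `S₂ ⟶ S₃`. -/
theorem exists_lift_of_extOneVanishes (hE : ∀ A, IsExactStructure (E A))
    {S : ShortComplex (AddFunctor d)} (hS : pointwiseExactStructure d E S)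
    (h : ExtOneVanishes (pointwiseExactStructure d E) X S.X₁) (f : X ⟶ S.X₃) :
    ∃ g : X ⟶ S.X₂, g ≫ S.g = f := by
  obtain ⟨P, i, p, hip, j, h₁₂, h₂₃, hT⟩ := exists_pullback S (shortExact_ev hE hS) f
  let φ : ShortComplex.mk i p hip ⟶ S :=
    { τ₁ := 𝟙 _
      τ₂ := j
      τ₃ := f
      comm₁₂ := by simp [h₁₂]
      comm₂₃ := h₂₃ }
  have : IsIso φ.τ₁ := inferInstanceAs (IsIso (𝟙 _))
  obtain ⟨T, ⟨τ⟩⟩ := exists_split_extension hE X S.X₁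
  obtain ⟨σ⟩ := h.splitting T τ
    ⟨P, i, p, hip, pointwiseExactStructure_of_isIso_τ₁ hE φ hT hS⟩
  have hσ : σ.s ≫ p = 𝟙 _ := σ.s_g
  exact ⟨σ.s ≫ j, by rw [Category.assoc, h₂₃, reassoc_of% hσ]⟩

end Extensions

end AddFunctor

namespace AddFunctor

variable {R : Type u} [Ring R] {𝒜 : Type u} [SmallCategory 𝒜] [Preadditive 𝒜]
  {d : RingActionOn R 𝒜} {X Y : AddFunctor d} {A : 𝒜}

/-! ### The adjunction between `qAt` and evaluation, and the universal property of `q` -/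

section TensorAdjunction

theorem HomTensor.tmul_smul {B : 𝒜} {M : Type u} [AddCommGroup M] [Module (End A) M]
    (g : A ⟶ B) (f : End A) (m : M) :
    HomTensor.tmul d g (f • m) = HomTensor.tmul d ((f : A ⟶ A) ≫ g) m :=
  ((Submodule.Quotient.eq (balancedRelations A B M)).2
    (Submodule.subset_span ⟨g, f, m, rfl⟩)).symm

/-- The additive map out of `Hom(A,B) ⊗_{R_A} M` induced by a balanced biadditive map. -/
def HomTensor.desc (d : RingActionOn R 𝒜) {B : 𝒜} {M N : Type u} [AddCommGroup M]
    [Module (End A) M] [AddCommGroup N] (b : (A ⟶ B) →ₗ[ℤ] M →ₗ[ℤ] N)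
    (hb : ∀ g (f : End A) m, b ((f : A ⟶ A) ≫ g) m = b g (f • m)) : HomTensor d A B M →+ N :=
  ((balancedRelations A B M).liftQ (TensorProduct.lift b) (by
    refine Submodule.span_le.2 ?_
    rintro _ ⟨g, f, m, rfl⟩
    change TensorProduct.lift b _ = 0
    rw [map_sub, TensorProduct.lift.tmul, TensorProduct.lift.tmul, hb, sub_self])).toAddMonoidHom

@[simp]
theorem HomTensor.desc_tmul {B : 𝒜} {M N : Type u} [AddCommGroup M]
    [Module (End A) M] [AddCommGroup N] (b : (A ⟶ B) →ₗ[ℤ] M →ₗ[ℤ] N)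
    (hb : ∀ g (f : End A) m, b ((f : A ⟶ A) ≫ g) m = b g (f • m)) (g : A ⟶ B) (m : M) :
    HomTensor.desc d b hb (HomTensor.tmul d g m) = b g m :=
  TensorProduct.lift.tmul (f' := b) g m

variable {M : ModuleCat.{u} (End A)}

/-- The unit `M ⟶ q_A(M)(A)`. -/
def qAtUnit (d : RingActionOn R 𝒜) (M : ModuleCat.{u} (End A)) :
    M ⟶ (ev d A).obj ((qAt d A).obj M) :=
  ModuleCat.ofHom (Y := ((qAt d A).obj M).Value A)
    { toFun := fun m => HomTensor.tmul d (𝟙 A) m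
      map_add' := HomTensor.tmul_add_right (𝟙 A)
      map_smul' := fun f m => (HomTensor.tmul_smul (𝟙 A) f m).trans (by
        rw [Category.comp_id]
        exact congrArg (fun g => HomTensor.tmul d g m) (Category.id_comp (f : A ⟶ A)).symm) }

theorem lin_qAtUnit {B : 𝒜} (g : A ⟶ B) (m : M) :
    ((qAt d A).obj M).lin g ((qAtUnit d M).hom m) = HomTensor.tmul d g m :=
  congrArg (fun g => HomTensor.tmul d g m) (Category.id_comp g)

/-- Yoneda argument: g ⊗ m is the image of 1 ⊗ m under q_A(M)(g), so naturality determines a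
morphism from its restriction along the unit. -/
theorem qAt_hom_ext {α β : (qAt d A).obj M ⟶ Y}
    (h : qAtUnit d M ≫ (ev d A).map α = qAtUnit d M ≫ (ev d A).map β) : α = β :=
  hom_ext fun B x => DFunLike.congr_fun (HomTensor.hom_ext
    (φ := (comp α B).toAddMonoidHom) (ψ := (comp β B).toAddMonoidHom) fun g m => by
      rw [← lin_qAtUnit]
      exact (comp_lin α g _).trans ((congrArg (fun φ => Y.lin g (φ.hom m)) h).trans
        (comp_lin β g _).symm)) x

/-- The morphism `q_A(M) ⟶ Y` corresponding to `M ⟶ Y(A)`. -/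
def qAtDesc (φ : M ⟶ (ev d A).obj Y) : (qAt d A).obj M ⟶ Y :=
  let φ' : M →ₗ[End A] Y.Value A := φ.hom
  let b (B : 𝒜) : (A ⟶ B) →ₗ[ℤ] M →ₗ[ℤ] Y.obj.obj B :=
    (AddMonoidHom.mk' (fun g : A ⟶ B =>
        ((Y.lin g).toAddMonoidHom.comp φ'.toAddMonoidHom).toIntLinearMap)
      fun g g' => LinearMap.ext fun m => Y.lin_add g g' (φ' m)).toIntLinearMap
  let l (B : 𝒜) : HomTensor d A B M →+ Y.obj.obj B := HomTensor.desc d (b B) fun g f m => by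
    exact (Y.lin_comp (f : A ⟶ A) g (φ' m)).trans (congrArg (Y.lin g) (map_smul φ' f m).symm)
  have l_tmul {B : 𝒜} (g : A ⟶ B) (m : M) : l B (HomTensor.tmul d g m) = Y.lin g (φ' m) :=
    HomTensor.desc_tmul _ _ _ _
  have hl {B B' : 𝒜} (f : B ⟶ B') (x : HomTensor d A B M) :
      l B' (HomTensor.map d f LinearMap.id x) = Y.lin f (l B x) :=
    DFunLike.congr_fun (HomTensor.hom_ext
      (φ := (l B').comp (HomTensor.map d f LinearMap.id))
      (ψ := (Y.lin f).toAddMonoidHom.comp (l B)) fun g m =>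
        (l_tmul (g ≫ f) m).trans
          ((Y.lin_comp g f (φ' m)).trans (congrArg (Y.lin f) (l_tmul g m).symm))) x
  homOfLin (X := (qAt d A).obj M) (fun B =>
    { toFun := l B
      map_add' := map_add (l B)
      -- On both functors `r` acts through δ_B(r), so `R`-linearity is naturality at δ_B(r).
      map_smul' := fun r x => (hl _ x).trans (Y.lin_δ B r _) }) hl

theorem qAtUnit_desc (φ : M ⟶ (ev d A).obj Y) : qAtUnit d M ≫ (ev d A).map (qAtDesc φ) = φ :=
  ModuleCat.hom_ext (LinearMap.ext fun m => Y.lin_id A (φ.hom m))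

theorem qAtUnit_naturality {M N : ModuleCat.{u} (End A)} (φ : M ⟶ N) :
    qAtUnit d M ≫ (ev d A).map ((qAt d A).map φ) = φ ≫ qAtUnit d N :=
  ModuleCat.hom_ext (LinearMap.ext fun m =>
    congrArg (fun g => HomTensor.tmul d g (φ.hom m)) (Category.comp_id (𝟙 A)))

variable (M : ∀ A : 𝒜, ModuleCat.{u} (End A))

/-- The inclusion of `q_A(M_A)` in `q(M)`. -/
noncomputable def qIncl (A : 𝒜) : (qAt d A).obj (M A) ⟶ (q d).obj M := by
  classical
  exact homOfLin (Y := (q d).obj M)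
    (fun B => DirectSum.lof R 𝒜 (fun A => ((qAt d A).obj (M A)).obj.obj B) A)
    fun f x => (DirectSum.lmap_lof (fun A => ((qAt d A).obj (M A)).lin f) A x).symm

variable {M}

theorem q_hom_ext {α β : (q d).obj M ⟶ Y} (h : ∀ A, qIncl M A ≫ α = qIncl M A ≫ β) : α = β := by
  classical
  refine hom_ext fun B x => DFunLike.congr_fun (f := comp α B) (g := comp β B)
    (DirectSum.linearMap_ext R fun A => LinearMap.ext fun x => ?_) x
  exact congrArg (fun γ => comp γ B x) (h A)

/-- The morphism `q(M) ⟶ Y` with given components. -/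
noncomputable def qDesc (α : ∀ A, (qAt d A).obj (M A) ⟶ Y) : (q d).obj M ⟶ Y := by
  classical
  exact homOfLin (X := (q d).obj M) (fun B => DirectSum.toModule R 𝒜 (Y.obj.obj B)
    fun A => comp (α A) B) fun {B B'} f x => by
      refine DFunLike.congr_fun
        (f := (DirectSum.toModule R 𝒜 _ fun A => comp (α A) B').comp (((q d).obj M).lin f))
        (g := (Y.lin f).comp (DirectSum.toModule R 𝒜 _ fun A => comp (α A) B))
        (DirectSum.linearMap_ext R fun A => LinearMap.ext fun x => ?_) x
      refine (congrArg (DirectSum.toModule R 𝒜 _ fun A => comp (α A) B')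
        (DirectSum.lmap_lof (fun A => ((qAt d A).obj (M A)).lin f) A x)).trans ?_
      refine (DirectSum.toModule_lof R A _).trans ((comp_lin (α A) f x).trans ?_)
      exact congrArg (Y.lin f) (DirectSum.toModule_lof (φ := fun A => comp (α A) B) R A x).symm

theorem qIncl_desc (α : ∀ A, (qAt d A).obj (M A) ⟶ Y) (A : 𝒜) :
    qIncl M A ≫ qDesc α = α A := by
  classical
  exact hom_ext fun B x => DirectSum.toModule_lof (φ := fun A => comp (α A) B) R A x

theorem qAt_hom_eq_of_subsingleton {M : ModuleCat.{u} (End A)} [Subsingleton M]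
    (α β : (qAt d A).obj M ⟶ Y) : α = β :=
  qAt_hom_ext ((ModuleCat.isZero_of_subsingleton M).eq_of_src _ _)

/-- `q(M)` is `q_A(M_A)` if all other components of `M` are zero. -/
theorem nonempty_qAt_iso_q (A : 𝒜) (hM : ∀ B, B ≠ A → Subsingleton (M B)) :
    Nonempty ((qAt d A).obj (M A) ≅ (q d).obj M) := by
  classical
  -- The projection to the summand at `A`: the identity there and zero elsewhere, with `eqToHom`
  -- absorbing the dependence of the type on `B`.
  let α (B : 𝒜) : (qAt d B).obj (M B) ⟶ (qAt d A).obj (M A) :=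
    if h : B = A then eqToHom (by rw [h]) else 0
  have hα : qIncl M A ≫ qDesc α = 𝟙 _ := by
    rw [qIncl_desc]
    exact dif_pos rfl
  refine ⟨⟨qIncl M A, qDesc α, hα, q_hom_ext fun B => ?_⟩⟩
  by_cases h : B = A
  · subst h
    rw [reassoc_of% hα, Category.comp_id]
  · have := hM B h
    exact qAt_hom_eq_of_subsingleton _ _

end TensorAdjunction

/-! ### The adjunction between evaluation and `pAt`, and the universal property of `p` -/

section HomAdjunction

variable {M : ModuleCat.{u} (End A)}

/-- The counit `p_A(M)(A) ⟶ M`. -/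
def pAtCounit (d : RingActionOn R 𝒜) (M : ModuleCat.{u} (End A)) :
    (ev d A).obj ((pAt d A).obj M) ⟶ M :=
  ModuleCat.ofHom (X := ((pAt d A).obj M).Value A)
    { toFun := fun h => HomHom.eval (d := d) (B := A) h (𝟙 A)
      map_add' := fun _ _ => rfl
      map_smul' := fun f h => by
        refine Eq.trans ?_ (map_smul (HomHom.toLin (d := d) (B := A) h) f (𝟙 A))
        refine congrArg (HomHom.toLin (d := d) (B := A) h) ?_
        exact (Category.comp_id (f : A ⟶ A)).trans (Category.id_comp (f : A ⟶ A)).symm }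

theorem pAtCounit_lin {B : 𝒜} (g : B ⟶ A) (h : ((pAt d A).obj M).obj.obj B) :
    (pAtCounit d M).hom (((pAt d A).obj M).lin g h) = HomHom.eval (d := d) h g :=
  congrArg (HomHom.toLin (d := d) h) (Category.comp_id g)

/-- The value of h at g is the counit applied to p_A(M)(g)(h), so naturality determines a morphism
into p_A(M) from its composite with the counit. -/
theorem pAt_hom_ext {α β : X ⟶ (pAt d A).obj M}
    (h : (ev d A).map α ≫ pAtCounit d M = (ev d A).map β ≫ pAtCounit d M) : α = β :=
  hom_ext fun B x => HomHom.ext (d := d) fun g => by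
    rw [← pAtCounit_lin, ← pAtCounit_lin, ← comp_lin, ← comp_lin]
    exact congrArg (fun φ => φ.hom (X.lin g x)) h

/-- The morphism `X ⟶ p_A(M)` corresponding to `X(A) ⟶ M`. -/
def pAtLift (φ : (ev d A).obj X ⟶ M) : X ⟶ (pAt d A).obj M :=
  let φ' : X.Value A →ₗ[End A] M := φ.hom
  let l (B : 𝒜) (x : X.obj.obj B) : HomHom d A B M :=
    { toFun := fun g => φ' (X.lin g x)
      map_add' := fun g g' => by
        rw [lin_add]
        exact map_add φ' _ _
      map_smul' := fun f g => by
        change φ' (X.lin (g ≫ (f : A ⟶ A)) x) = _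
        rw [lin_comp]
        exact map_smul φ' f _ }
  homOfLin (Y := (pAt d A).obj M) (fun B =>
    { toFun := l B
      map_add' := fun x y => HomHom.ext (d := d) fun g =>
        (congrArg φ' (map_add (X.lin g) x y)).trans (map_add φ' _ _)
      map_smul' := fun r x => HomHom.ext (d := d) fun g => congrArg φ' (by
        rw [← lin_δ, ← lin_comp]
        rfl) })
    fun f x => HomHom.ext (d := d) fun g => congrArg φ' (X.lin_comp f g x).symm

theorem pAtLift_counit (φ : (ev d A).obj X ⟶ M) : (ev d A).map (pAtLift φ) ≫ pAtCounit d M = φ :=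
  ModuleCat.hom_ext (LinearMap.ext fun x => congrArg φ.hom (X.lin_id A x))

theorem pAtCounit_naturality {M N : ModuleCat.{u} (End A)} (φ : M ⟶ N) :
    (ev d A).map ((pAt d A).map φ) ≫ pAtCounit d N = pAtCounit d M ≫ φ :=
  ModuleCat.hom_ext (LinearMap.ext fun h =>
    congrArg (fun g => φ.hom (HomHom.toLin (d := d) (B := A) h g)) (Category.comp_id (𝟙 A)))

variable (M : ∀ A : 𝒜, ModuleCat.{u} (End A))

/-- The projection from `p(M)` to `p_A(M_A)`. -/
def pProj (A : 𝒜) : (p d).obj M ⟶ (pAt d A).obj (M A) :=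
  homOfLin (X := (p d).obj M)
    (fun B => LinearMap.proj (φ := fun A => ((pAt d A).obj (M A)).obj.obj B) A) fun _ _ => rfl

variable {M}

theorem p_hom_ext {α β : X ⟶ (p d).obj M} (h : ∀ A, α ≫ pProj M A = β ≫ pProj M A) : α = β :=
  hom_ext fun B x => funext fun A => congrArg (fun γ => comp γ B x) (h A)

/-- The morphism `X ⟶ p(M)` with given components. -/
def pLift (α : ∀ A, X ⟶ (pAt d A).obj (M A)) : X ⟶ (p d).obj M :=
  homOfLin (Y := (p d).obj M) (fun B => LinearMap.pi fun A => comp (α A) B)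
    fun f x => funext fun A => comp_lin (α A) f x

theorem pLift_proj (α : ∀ A, X ⟶ (pAt d A).obj (M A)) (A : 𝒜) :
    pLift α ≫ pProj M A = α A := rfl

theorem pAt_hom_eq_of_subsingleton {M : ModuleCat.{u} (End A)} [Subsingleton M]
    (α β : X ⟶ (pAt d A).obj M) : α = β :=
  pAt_hom_ext ((ModuleCat.isZero_of_subsingleton M).eq_of_tgt _ _)

/-- `p(M)` is `p_A(M_A)` if all other components of `M` are zero. -/
theorem nonempty_pAt_iso_p (A : 𝒜) (hM : ∀ B, B ≠ A → Subsingleton (M B)) :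
    Nonempty ((pAt d A).obj (M A) ≅ (p d).obj M) := by
  classical
  let α (B : 𝒜) : (pAt d A).obj (M A) ⟶ (pAt d B).obj (M B) :=
    if h : B = A then eqToHom (by rw [h]) else 0
  have hα : pLift α ≫ pProj M A = 𝟙 _ := by
    rw [pLift_proj]
    exact dif_pos rfl
  refine ⟨⟨pLift α, pProj M A, hα, p_hom_ext fun B => ?_⟩⟩
  by_cases h : B = A
  · subst h
    rw [Category.assoc, hα, Category.comp_id, Category.id_comp]
  · have := hM B h
    exact pAt_hom_eq_of_subsingleton _ _

end HomAdjunction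

/-! ### Transport of Ext¹-vanishing along the adjunctions -/

section ExtComparison

variable {E : ∀ A : 𝒜, ObjectProperty (ShortComplex (ModuleCat.{u} (End A)))}

theorem extOneVanishes_ev_of_qAt (hE : ∀ A, IsExactStructure (E A)) {M : ModuleCat.{u} (End A)}
    (hM : IsFlatObject (E A) (pointwiseExactStructure d E) (qAt d A) M)
    (h : ExtOneVanishes (pointwiseExactStructure d E) ((qAt d A).obj M) X) :
    ExtOneVanishes (E A) M ((ev d A).obj X) := by
  refine extOneVanishes_of_splitting fun S => ?_
  -- Flatness keeps `S` exact under q_A, so the counit `qAtDesc (𝟙 _)` extends to `g`. By the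
  -- triangle identity the transpose of `g` is a retraction of `S.i`.
  obtain ⟨g, hg⟩ : ∃ g : (qAt d A).obj S.mid ⟶ X,
      (qAt d A).map S.i ≫ g = qAtDesc (𝟙 ((ev d A).obj X)) :=
    exists_extension_of_extOneVanishes hE (hM S.i S.p S.zero S.mem) h _
  refine ((hE A).kernelCokernel _ S.mem).splitting_of_retraction
    (qAtUnit d S.mid ≫ (ev d A).map g) ?_
  change S.i ≫ qAtUnit d S.mid ≫ (ev d A).map g = 𝟙 _
  rw [← Category.assoc, ← qAtUnit_naturality, Category.assoc, ← Functor.map_comp, hg, qAtUnit_desc]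

/-- A section out of q(M) amounts to one linear map out of each M_A, so the lifting problem is
solved in each `E A` separately. -/
theorem extOneVanishes_q (hE : ∀ A, IsExactStructure (E A)) {M : ∀ A : 𝒜, ModuleCat.{u} (End A)}
    (h : ∀ A, ExtOneVanishes (E A) (M A) ((ev d A).obj X)) :
    ExtOneVanishes (pointwiseExactStructure d E) ((q d).obj M) X := by
  refine extOneVanishes_of_splitting fun S => ?_
  have hl (A : 𝒜) : ∃ l : M A ⟶ (ev d A).obj S.mid,
      l ≫ (ev d A).map S.p = qAtUnit d (M A) ≫ (ev d A).map (qIncl M A) :=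
    (hE A).exists_lift (S.mem.2 A) (h A) _
  choose l hl using hl
  refine S.mem.1.splitting_of_section (qDesc fun A => qAtDesc (l A)) (q_hom_ext fun A => ?_)
  rw [← Category.assoc, qIncl_desc, Category.comp_id]
  refine qAt_hom_ext ?_
  rw [Functor.map_comp, ← Category.assoc, qAtUnit_desc]
  exact hl A

theorem extOneVanishes_ev_of_pAt (hE : ∀ A, IsExactStructure (E A)) {M : ModuleCat.{u} (End A)}
    (hM : IsCoflatObject (E A) (pointwiseExactStructure d E) (pAt d A) M)
    (h : ExtOneVanishes (pointwiseExactStructure d E) X ((pAt d A).obj M)) :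
    ExtOneVanishes (E A) ((ev d A).obj X) M := by
  refine extOneVanishes_of_splitting fun S => ?_
  -- Dually, coflatness lets the unit X ⟶ p_A(X(A)) lift to `g`, whose transpose is a section of
  -- `S.p`.
  obtain ⟨g, hg⟩ : ∃ g : X ⟶ (pAt d A).obj S.mid,
      g ≫ (pAt d A).map S.p = pAtLift (𝟙 ((ev d A).obj X)) :=
    exists_lift_of_extOneVanishes hE (hM S.i S.p S.zero S.mem) h _
  refine ((hE A).kernelCokernel _ S.mem).splitting_of_section
    ((ev d A).map g ≫ pAtCounit d S.mid) ?_
  change ((ev d A).map g ≫ pAtCounit d S.mid) ≫ S.p = 𝟙 _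
  rw [Category.assoc, ← pAtCounit_naturality, ← Category.assoc, ← Functor.map_comp, hg,
    pAtLift_counit]

theorem extOneVanishes_p (hE : ∀ A, IsExactStructure (E A)) {M : ∀ A : 𝒜, ModuleCat.{u} (End A)}
    (h : ∀ A, ExtOneVanishes (E A) ((ev d A).obj X) (M A)) :
    ExtOneVanishes (pointwiseExactStructure d E) X ((p d).obj M) := by
  refine extOneVanishes_of_splitting fun S => ?_
  have hl (A : 𝒜) : ∃ l : (ev d A).obj S.mid ⟶ M A,
      (ev d A).map S.i ≫ l = (ev d A).map (pProj M A) ≫ pAtCounit d (M A) :=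
    (hE A).exists_extension (S.mem.2 A) (h A) _
  choose l hl using hl
  refine S.mem.1.splitting_of_retraction (pLift fun A => pAtLift (l A)) (p_hom_ext fun A => ?_)
  rw [Category.assoc, pLift_proj, Category.id_comp]
  refine pAt_hom_ext ?_
  rw [Functor.map_comp, Category.assoc, pAtLift_counit]
  exact hl A

end ExtComparison

/-! ### Families concentrated at one object -/

section SingleFamily

open Classical in
/-- The family with value `N` at `A` and zero elsewhere. -/
noncomputable def single (A : 𝒜) (N : ModuleCat.{u} (End A)) : ∀ B : 𝒜, ModuleCat.{u} (End B) :=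
  Function.update (fun _ => ModuleCat.of _ PUnit) A N

theorem single_self (A : 𝒜) (N : ModuleCat.{u} (End A)) : single A N A = N :=
  by classical exact Function.update_self ..

theorem single_of_ne {A B : 𝒜} (h : B ≠ A) (N : ModuleCat.{u} (End A)) :
    single A N B = ModuleCat.of _ PUnit :=
  by classical exact Function.update_of_ne h ..

theorem subsingleton_single {A B : 𝒜} (h : B ≠ A) (N : ModuleCat.{u} (End A)) :
    Subsingleton (single A N B) := by
  rw [single_of_ne h]
  exact inferInstanceAs (Subsingleton PUnit)

theorem productClass_single {F : ∀ A : 𝒜, ObjectProperty (ModuleCat.{u} (End A))}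
    (h₀ : ∀ A, F A (ModuleCat.of _ PUnit)) {N : ModuleCat.{u} (End A)} (hN : F A N) :
    productClass F (single A N) := by
  intro B
  by_cases h : B = A
  · subst h
    rwa [single_self]
  · rw [single_of_ne h]
    exact h₀ B

theorem nonempty_qAt_iso_q_single (N : ModuleCat.{u} (End A)) :
    Nonempty ((q d).obj (single A N) ≅ (qAt d A).obj N) := by
  obtain ⟨e⟩ := nonempty_qAt_iso_q (d := d) (M := single A N) A fun B h => subsingleton_single h N
  exact ⟨e.symm ≪≫ (qAt d A).mapIso (eqToIso (single_self A N))⟩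

theorem nonempty_pAt_iso_p_single (N : ModuleCat.{u} (End A)) :
    Nonempty ((p d).obj (single A N) ≅ (pAt d A).obj N) := by
  obtain ⟨e⟩ := nonempty_pAt_iso_p (d := d) (M := single A N) A fun B h => subsingleton_single h N
  exact ⟨e.symm ≪≫ (pAt d A).mapIso (eqToIso (single_self A N))⟩

end SingleFamily

end AddFunctor

/-! ### Zero objects in the two classes of the cotorsion pair -/

section Zero

variable {I : Type u} {R : I → Type u} [∀ i, Ring (R i)]
  {E : ∀ i, ObjectProperty (ShortComplex (ModuleCat.{u} (R i)))}
  {F G : ∀ i, ObjectProperty (ModuleCat.{u} (R i))}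

/-- Every extension of a zero object splits, so the zero family is left orthogonal to everything.
This makes `single A N` a member of the product class. -/
theorem IsCotorsionPair.left_zero (hE : ∀ i, IsExactStructure (E i))
    (h : IsCotorsionPair (productExactStructure E) (productClass F) (productClass G)) (i : I) :
    F i (ModuleCat.of _ PUnit) := by
  have : productClass F fun i => ModuleCat.of (R i) PUnit := by
    rw [h.leftPerp_eq]
    exact fun Y _ => ExtOneVanishes.pi fun i =>
      (hE i).extOneVanishes_of_isZero_left (ModuleCat.isZero_of_subsingleton _) _
  exact this i

theorem IsCotorsionPair.right_zero (hE : ∀ i, IsExactStructure (E i))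
    (h : IsCotorsionPair (productExactStructure E) (productClass F) (productClass G)) (i : I) :
    G i (ModuleCat.of _ PUnit) := by
  have : productClass G fun i => ModuleCat.of (R i) PUnit := by
    rw [← h.rightPerp_eq]
    exact fun Y _ => ExtOneVanishes.pi fun i =>
      (hE i).extOneVanishes_of_isZero_right _ (ModuleCat.isZero_of_subsingleton _)
  exact this i

end Zero

/-! ### The two orthogonality statements -/

theorem proposition4p12 {R : Type u} [Ring R] {𝒜 : Type u} [SmallCategory 𝒜] [Preadditive 𝒜]
    (d : RingActionOn R 𝒜)
    (E : ∀ A : 𝒜, ObjectProperty (ShortComplex (ModuleCat.{u} (End A))))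
    (hE : ∀ A, IsExactStructure (E A))
    (F G : ∀ A : 𝒜, ObjectProperty (ModuleCat.{u} (End A)))
    (hFG : IsCotorsionPair (productExactStructure E) (productClass F) (productClass G)) :
    ((∀ (A : 𝒜) (M : ModuleCat.{u} (End A)), F A M →
        IsFlatObject (E A) (AddFunctor.pointwiseExactStructure d E) (AddFunctor.qAt d A) M) →
      rightPerp (AddFunctor.pointwiseExactStructure d E)
          ((productClass F).strictMap (AddFunctor.q d)) =
        fun X => ∀ A : 𝒜, G A ((AddFunctor.ev d A).obj X)) ∧
    ((∀ (A : 𝒜) (M : ModuleCat.{u} (End A)), G A M →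
        IsCoflatObject (E A) (AddFunctor.pointwiseExactStructure d E) (AddFunctor.pAt d A) M) →
      leftPerp (AddFunctor.pointwiseExactStructure d E)
          ((productClass G).strictMap (AddFunctor.p d)) =
        fun X => ∀ A : 𝒜, F A ((AddFunctor.ev d A).obj X)) := by
  constructor
  · intro hflat
    funext X
    refine propext ⟨fun hX => ?_, fun hX => ?_⟩
    · change productClass G fun A => (AddFunctor.ev d A).obj X
      rw [← hFG.rightPerp_eq]
      intro M hM
      refine ExtOneVanishes.pi fun A => ?_
      -- Orthogonality is known only against objects of the form q(family). Testing on the family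
      -- concentrated at `A` gives it against q_A(M_A), up to the isomorphism `e`.
      obtain ⟨e⟩ := AddFunctor.nonempty_qAt_iso_q_single (d := d) (M A)
      exact AddFunctor.extOneVanishes_ev_of_qAt hE (hflat A _ (hM A))
        ((hX _ ⟨_, AddFunctor.productClass_single (hFG.left_zero hE) (hM A)⟩).of_iso_left
          (AddFunctor.pointwiseExactStructure_of_iso hE) e)
    · rintro _ ⟨M, hM⟩
      have hX' : productClass G fun A => (AddFunctor.ev d A).obj X := hX
      rw [← hFG.rightPerp_eq] at hX'
      exact AddFunctor.extOneVanishes_q hE ((extOneVanishes_pi_iff hE _ _).1 (hX' M hM))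
  · intro hcoflat
    funext X
    refine propext ⟨fun hX => ?_, fun hX => ?_⟩
    · change productClass F fun A => (AddFunctor.ev d A).obj X
      rw [hFG.leftPerp_eq]
      intro M hM
      refine ExtOneVanishes.pi fun A => ?_
      obtain ⟨e⟩ := AddFunctor.nonempty_pAt_iso_p_single (d := d) (M A)
      exact AddFunctor.extOneVanishes_ev_of_pAt hE (hcoflat A _ (hM A))
        ((hX _ ⟨_, AddFunctor.productClass_single (hFG.right_zero hE) (hM A)⟩).of_iso_right
          (AddFunctor.pointwiseExactStructure_of_iso hE) e)
    · rintro _ ⟨M, hM⟩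
      have hX' : productClass F fun A => (AddFunctor.ev d A).obj X := hX
      rw [hFG.leftPerp_eq] at hX'
      exact AddFunctor.extOneVanishes_p hE ((extOneVanishes_pi_iff hE _ _).1 (hX' M hM))
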